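/- **Setting.** Fix $N\in\mathbb N$, a countable set $\chi\subseteq\mathbb R^N$ with $0\in\chi$, and an integer $n\ge 6$. Let $\mathcal G$ be the class of all finite simple graphs with at most $n$ nodes and node features in $\chi$. Fix a real-analytic activation function $\sigma:\mathbb R\to\mathbb R$ with two distinct finite limits at $\pm\infty$ (e.g. the logistic function or $\tanh$). A *perceptron* (MLP) has at least one hidden layer, of any width, activation $\sigma$ in the hidden layers and an affine output layer. **Tests.** The *WL test* starts with the node features as colors; in each round the new color of a node is the pair (old color, multiset of the colors of its neighbors). *$3$-WL* colors triples of nodes; the initial color of a triple is its isomorphism type (features, equality pattern, adjacency pattern), and the new color of a triple consists of its old color and, for each $j\in\{1,2,3\}$, the multiset of the colors of the triples obtained by replacing the $j$-th entry by an arbitrary node. A test *distinguishes* two graphs if after some number of rounds their multisets of colors differ. **GNNs.** *GIN*: an MLP is applied to each input feature, followed by at least one layer $x_v\mapsto \mathrm{MLP}_k\big((1+\varepsilon_k)x_v+\sum_{u\in N(v)}x_u\big)$; the output is a node coloring. *PPGN*: the input is the tensor indexed by pairs of nodes whose channels are the node features (on the diagonal, $0$ elsewhere), the adjacency matrix and the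 identity matrix, followed by at least one block $Y\mapsto[\,m_3(Y)\,|\,m_1(Y)\cdot m_2(Y)\,]$ ($m_i$ MLPs acting on the channels of each pair, $\cdot$ the channelwise matrix product, $[\cdot|\cdot]$ concatenation). The node coloring extracted from the output $Y$ is its diagonal $u\mapsto Y_{uu}$. **LGVR.** Let $G$ have node coloring $\mathcal C:V(G)\to\mathbb R^d$. Color the node of the line graph $L_G$ that belongs to an edge $\{u,v\}$ by $\phi(\{\{\mathcal C(u),\mathcal C(v)\}\})$, where $\phi(\{\{x,y\}\})=(g(x)+g(y),|g(x)-g(y)|)\in\mathbb R^{2d}$, $g(z)=z+\eta\, m(z)$, $m$ an MLP, $\eta\in\mathbb R$, $|\cdot|$ entrywise. Apply a GIN $P_1$ on $L_G$, extend the resulting coloring by $0$ to the line graph $L_{K_G}$ of the complete graph on $V(G)$, and apply there a scalar GIN $P_2$ followed by the logistic function. Let $A_{uv}\in[0,1]$ be the value obtained at $\{u,v\}$, and $A_{uu}=0$. Then $\mathrm{LGVR}(G,\mathcal C)=(\mathrm{ph}^0,\mathrm{ph}^1)$ is the pair of persistence diagrams (multisets of (birth, death) pairs, death $\infty$ for classes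 that do not die; homology over $\mathbb Z/2$) of the filtration $\{\mathrm{VR}_1^{\varepsilon}(V(G),A)\}_{\varepsilon\in[0,1/2]}$ by $1$-skeleta of Vietoris–Rips complexes. It is encoded by $\mathrm{ENC}=\mathrm{MLP}\big(\sum_{p\in\mathrm{ph}^0}S_0(p),\ \sum_{p\in\mathrm{ph}^1}S_1(p)\big)$ with MLPs $S_0,S_1$ on $\mathbb R^2$, where the death $\infty$ is entered as $1$. **Models.** *GIN-LGVR* represents $G$ by $\mathrm{ENC}(\mathrm{LGVR}(G,\mathcal C))$, $\mathcal C$ the GIN coloring of $G$. *GIN-LGVR⁺* and *PPGN-LGVR⁺* represent $G$ by $\mathrm{ENC}(\mathrm{LGVR}(G,\mathcal C))+(1+\varepsilon)\sum_{u\in V(G)}\mathcal C(u)$, with $\varepsilon\in\mathbb R$ learnable and $\mathcal C$ the GIN coloring, respectively the node coloring extracted from PPGN. Numbers of layers, widths and dimensions are free and are part of the weights. A model is *at least as powerful* as a test on a class of graphs if there are weights, the same for the whole class, such that any two graphs of the class that the test distinguishes have different representations. It is *strictly more powerful* if the weights can be chosen such that, in addition, some two graphs of the class that the test does not distinguish have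 different representations. **Statement.** 1. For every $c\in\chi$, GIN-LGVR is strictly more powerful than the WL test on the class of those graphs in $\mathcal G$ all of whose node features equal $c$. Also, GIN-LGVR is strictly more powerful than the WL test on the class of those graphs in $\mathcal G$ that have no isolated nodes. 2. GIN-LGVR⁺ is strictly more powerful than the WL test on $\mathcal G$. 3. PPGN-LGVR⁺ is at least as powerful as $3$-WL on $\mathcal G$. -/

import Mathlib

/-! ### Graphs with node features, colour refinement and its higher-order version -/

/-- A finite graph with node features in `ℝ^N`, on the node set `{0, …, order - 1}`
(every finite graph is isomorphic to one of these). -/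
structure FGraph (N : ℕ) where
  order : ℕ
  graph : SimpleGraph (Fin order)
  feat : Fin order → (Fin N → ℝ)

/-- Colours after `t` rounds of colour refinement. The hash of a round is the identity, hence
injective and the same for all graphs: the new colour is the pair of the old colour and the
multiset of the colours of the neighbours. -/
def WLColor (X : Type) : ℕ → Type
  | 0 => X
  | t + 1 => WLColor X t × Multiset (WLColor X t)

open Classical in
noncomputable def wlColor {V X : Type} [Fintype V] (G : SimpleGraph V) (x : V → X) :
    (t : ℕ) → V → WLColor X t
  | 0 => x
  | t + 1 => fun v =>
      (wlColor G x t v, (Finset.univ.filter (fun u => G.Adj v u)).val.map (wlColor G x t))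

/-- The WL test, with the node features as initial colours, distinguishes `G` and `H`: after some
number of rounds the histograms (multisets) of colours differ. -/
def WLDistinguishes {N : ℕ} (G H : FGraph N) : Prop :=
  ∃ t : ℕ, (Finset.univ : Finset (Fin G.order)).val.map (wlColor G.graph G.feat t) ≠
    (Finset.univ : Finset (Fin H.order)).val.map (wlColor H.graph H.feat t)

/-- Colours of `k`-tuples after `t` rounds of `k`-WL. The initial colour is the isomorphism type of
the tuple: features, equality pattern and adjacency pattern. The new colour consists of the old
colour and, for every position `j`, of a multiset of old colours. -/
def KWLColor (k : ℕ) (X : Type) : ℕ → Type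
  | 0 => (Fin k → X) × (Fin k → Fin k → Prop) × (Fin k → Fin k → Prop)
  | t + 1 => KWLColor k X t × (Fin k → Multiset (KWLColor k X t))

/-- In a round, the multiset for position `j` collects the colours of all tuples which arise by
replacing the `j`-th entry by an arbitrary node. -/
noncomputable def kwlColor {V X : Type} [Fintype V] (k : ℕ) (G : SimpleGraph V) (x : V → X) :
    (t : ℕ) → (Fin k → V) → KWLColor k X t
  | 0 => fun p => (fun i => x (p i), fun i j => p i = p j, fun i j => G.Adj (p i) (p j))
  | t + 1 => fun p => (kwlColor k G x t p, fun j =>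
      (Finset.univ : Finset V).val.map (fun u => kwlColor k G x t (Function.update p j u)))

def KWLDistinguishes {N : ℕ} (k : ℕ) (G H : FGraph N) : Prop :=
  ∃ t : ℕ,
    (Finset.univ : Finset (Fin k → Fin G.order)).val.map (kwlColor k G.graph G.feat t) ≠
    (Finset.univ : Finset (Fin k → Fin H.order)).val.map (kwlColor k H.graph H.feat t)

/-! ### Multi-layer perceptrons, GIN and PPGN -/

/-- Activation functions: real-analytic sigmoidal functions (two distinct finite limits at `±∞`),
such as the logistic function or `tanh`. -/
def IsAnalyticSigmoidal (σ : ℝ → ℝ) : Prop :=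
  AnalyticOnNhd ℝ σ Set.univ ∧
    ∃ a b : ℝ, a ≠ b ∧ Filter.Tendsto σ Filter.atBot (nhds a) ∧
      Filter.Tendsto σ Filter.atTop (nhds b)

/-- Weights of a multi-layer perceptron `ℝ^m → ℝ^n` with at least one hidden layer. -/
inductive MLP : ℕ → ℕ → Type
  | shallow {m h n : ℕ} (A : Matrix (Fin h) (Fin m) ℝ) (a : Fin h → ℝ)
      (B : Matrix (Fin n) (Fin h) ℝ) (b : Fin n → ℝ) : MLP m n
  | deep {m h n : ℕ} (A : Matrix (Fin h) (Fin m) ℝ) (a : Fin h → ℝ) (rest : MLP h n) : MLP m n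

/-- The activation `σ` is applied entrywise in the hidden layers; the output layer is affine. -/
noncomputable def MLP.eval (σ : ℝ → ℝ) : {m n : ℕ} → MLP m n → (Fin m → ℝ) → (Fin n → ℝ)
  | _, _, .shallow A a B b => fun x => B.mulVec (fun i => σ (A.mulVec x i + a i)) + b
  | _, _, .deep A a rest => fun x => rest.eval σ (fun i => σ (A.mulVec x i + a i))

/-- Weights of at least one GIN layer. -/
inductive GINLayers : ℕ → ℕ → Type
  | one {a b : ℕ} (ε : ℝ) (m : MLP a b) : GINLayers a b
  | cons {a b c : ℕ} (ε : ℝ) (m : MLP a b) (rest : GINLayers b c) : GINLayers a c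

/-- One GIN aggregation `v ↦ (1 + ε) x_v + ∑_{u ∈ N(v)} x_u`. -/
noncomputable def ginAggregate {V : Type} [Fintype V] (G : SimpleGraph V) {a : ℕ} (ε : ℝ)
    (x : V → (Fin a → ℝ)) (v : V) : Fin a → ℝ :=
  open Classical in (1 + ε) • x v + ∑ u ∈ Finset.univ.filter (fun u => G.Adj v u), x u

noncomputable def GINLayers.eval (σ : ℝ → ℝ) {V : Type} [Fintype V] (G : SimpleGraph V) :
    {a b : ℕ} → GINLayers a b → (V → (Fin a → ℝ)) → (V → (Fin b → ℝ))
  | _, _, .one ε m => fun x v => m.eval σ (ginAggregate G ε x v)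
  | _, _, .cons ε m rest => fun x => rest.eval σ G (fun v => m.eval σ (ginAggregate G ε x v))

/-- Weights of a GIN `ℝ^a → ℝ^b` at node level. The input features, which need not be one-hot
vectors, are passed through a perceptron before the first aggregation. -/
structure GIN (a b : ℕ) where
  width : ℕ
  init : MLP a width
  layers : GINLayers width b

noncomputable def GIN.eval (σ : ℝ → ℝ) {V : Type} [Fintype V] (G : SimpleGraph V) {a b : ℕ}
    (g : GIN a b) (x : V → (Fin a → ℝ)) : V → (Fin b → ℝ) :=
  g.layers.eval σ G (fun v => g.init.eval σ (x v))

/-- Weights of a PPGN block with `a` input channels, `b` matrix-product channels and `b'`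
channels of the direct path. -/
structure PPGNBlock (a b b' : ℕ) where
  m₁ : MLP a b
  m₂ : MLP a b
  m₃ : MLP a b'

/-- The block sends a tensor `Y` to the concatenation of `m₃(Y)` and the channelwise matrix
product of `m₁(Y)` and `m₂(Y)`, the perceptrons acting on the channels of each node pair. -/
noncomputable def PPGNBlock.eval (σ : ℝ → ℝ) {V : Type} [Fintype V] {a b b' : ℕ}
    (B : PPGNBlock a b b') (Y : V → V → (Fin a → ℝ)) (u v : V) : Fin (b' + b) → ℝ :=
  Fin.append (B.m₃.eval σ (Y u v))
    (fun c => ∑ w : V, B.m₁.eval σ (Y u w) c * B.m₂.eval σ (Y w v) c)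

/-- Weights of at least one PPGN block. -/
inductive PPGN : ℕ → ℕ → Type
  | one {a b b' : ℕ} (B : PPGNBlock a b b') : PPGN a (b' + b)
  | cons {a b b' c : ℕ} (B : PPGNBlock a b b') (rest : PPGN (b' + b) c) : PPGN a c

noncomputable def PPGN.eval (σ : ℝ → ℝ) {V : Type} [Fintype V] :
    {a b : ℕ} → PPGN a b → (V → V → (Fin a → ℝ)) → (V → V → (Fin b → ℝ))
  | _, _, .one B => fun Y => B.eval σ Y
  | _, _, .cons B rest => fun Y => rest.eval σ (B.eval σ Y)

/-- The input tensor of PPGN: node features on the diagonal, adjacency matrix, identity matrix. -/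
noncomputable def ppgnInput {N : ℕ} {V : Type} (G : SimpleGraph V) (x : V → (Fin N → ℝ))
    (u v : V) : Fin (N + 2) → ℝ :=
  open Classical in
  Fin.append (if u = v then x u else 0) ![if G.Adj u v then 1 else 0, if u = v then 1 else 0]

/-! ### Persistence diagrams of skeleta of Vietoris-Rips filtrations -/

/-- The Vietoris-Rips complex of `(V, M)` whose simplices are the nonempty sets of points with all
pairwise values of `M` in `I`. The scale-`ε` complex is the case `I = (-∞, ε]`; the case
`I = (-∞, ε)` is the union of the complexes of all scales smaller than `ε`. -/
def vrComplex {V : Type} (M : V → V → ℝ) (I : Set ℝ) : PreAbstractSimplicialComplex V where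
  faces := {s | s.Nonempty ∧ ∀ u ∈ s, ∀ v ∈ s, M u v ∈ I}
  isRelLowerSet_faces := fun _ hs =>
    ⟨hs.1, fun _ hts ht => ⟨ht, fun u hu v hv => hs.2 u (hts hu) v (hts hv)⟩⟩

/-- The `k`-skeleton. -/
def skeleton {V : Type} (k : ℕ) (K : PreAbstractSimplicialComplex V) :
    PreAbstractSimplicialComplex V where
  faces := {s | s ∈ K.faces ∧ s.card ≤ k + 1}
  isRelLowerSet_faces := fun _ hs =>
    ⟨(K.isRelLowerSet_faces hs.1).1, fun _ hts ht =>
      ⟨(K.isRelLowerSet_faces hs.1).2 hts ht, (Finset.card_le_card hts).trans hs.2⟩⟩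

/-- Simplicial `n`-chains, inside the space spanned by all finite sets of points. The coefficient
field `F` is a parameter here; it has characteristic two (so that simplices need no orientation),
and is `ℤ/2` below. -/
noncomputable def simplicialChains (F : Type) [Field F] {V : Type} (n : ℕ)
    (K : PreAbstractSimplicialComplex V) : Submodule F (Finset V →₀ F) :=
  Finsupp.supported F F {s | s ∈ K.faces ∧ s.card = n + 1}

/-- The boundary of a simplex is the sum of its facets. -/
noncomputable def simplicialBoundary (F : Type) [Field F] (V : Type) :
    (Finset V →₀ F) →ₗ[F] (Finset V →₀ F) :=
  open Classical in
  Finsupp.linearCombination F (fun s => ∑ v ∈ s, Finsupp.single (s.erase v) (1 : F))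

/-- `n`-cycles; every `0`-chain is a cycle (homology is not reduced). -/
noncomputable def simplicialCycles (F : Type) [Field F] {V : Type} (n : ℕ)
    (K : PreAbstractSimplicialComplex V) : Submodule F (Finset V →₀ F) :=
  if n = 0 then simplicialChains F 0 K
  else simplicialChains F n K ⊓ LinearMap.ker (simplicialBoundary F V)

noncomputable def simplicialBoundaries (F : Type) [Field F] {V : Type} (n : ℕ)
    (K : PreAbstractSimplicialComplex V) : Submodule F (Finset V →₀ F) :=
  (simplicialChains F (n + 1) K).map (simplicialBoundary F V)

/-- For `K ≤ L`, the rank of `H_n(K) → H_n(L)`: the dimension of the image of the cycles of `K` in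
the quotient by the boundaries of `L`, which contains `H_n(L)`. -/
noncomputable def persistentBetti (F : Type) [Field F] {V : Type} (n : ℕ)
    (K L : PreAbstractSimplicialComplex V) : ℕ :=
  Module.finrank F ((simplicialCycles F n K).map (simplicialBoundaries F n L).mkQ)

/-- `persistentBetti` over `ℤ/2` for the `1`-skeleta of the Vietoris-Rips complexes given by `I ⊆ J`. -/
noncomputable def vrBetti {V : Type} (n : ℕ) (M : V → V → ℝ) (I J : Set ℝ) : ℤ :=
  persistentBetti (ZMod 2) n (skeleton 1 (vrComplex M I)) (skeleton 1 (vrComplex M J))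

/-- Number of `n`-th homology classes which are born exactly at `b` and die exactly at `d`, where
`b < d`. -/
noncomputable def diagramMultiplicity {V : Type} (n : ℕ) (M : V → V → ℝ) (b d : ℝ) : ℕ :=
  ((vrBetti n M (Set.Iic b) (Set.Iio d) - vrBetti n M (Set.Iio b) (Set.Iio d)) -
    (vrBetti n M (Set.Iic b) (Set.Iic d) - vrBetti n M (Set.Iio b) (Set.Iic d))).toNat

/-- Number of `n`-th homology classes which are born exactly at `b ≤ r` and are still alive at the
largest scale `r` of the filtration. -/
noncomputable def essentialMultiplicity {V : Type} (n : ℕ) (M : V → V → ℝ) (r b : ℝ) : ℕ :=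
  (vrBetti n M (Set.Iic b) (Set.Iic r) - vrBetti n M (Set.Iio b) (Set.Iic r)).toNat

/-- The scales up to `r` at which the Vietoris-Rips complex can change. -/
noncomputable def criticalScales {V : Type} [Fintype V] (M : V → V → ℝ) (r : ℝ) : Finset ℝ :=
  open Classical in
  ((Finset.univ : Finset (V × V)).image (fun p => M p.1 p.2)).filter (fun t => t ≤ r)

/-- The `n`-th persistence diagram of the `1`-skeleta of the Vietoris-Rips filtration of `(V, M)`
with scales up to `r`, for symmetric `M ≥ 0` with zero diagonal: a multiset of pairs
(birth, death), where the death is `⊤` for the classes which do not die. -/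
noncomputable def persistenceDiagram {V : Type} [Fintype V] (n : ℕ) (M : V → V → ℝ) (r : ℝ) :
    Multiset (ℝ × WithTop ℝ) :=
  (∑ b ∈ criticalScales M r, ∑ d ∈ (criticalScales M r).filter (fun d => b < d),
      Multiset.replicate (diagramMultiplicity n M b d) (b, (d : WithTop ℝ))) +
    ∑ b ∈ criticalScales M r, Multiset.replicate (essentialMultiplicity n M r b) (b, ⊤)

/-! ### The line graph Vietoris-Rips persistence diagram -/

/-- The map `{{x, y}} ↦ (g(x) + g(y), |g(x) - g(y)|)` with `g(z) = z + η m(z)`. -/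
noncomputable def phiMap (σ : ℝ → ℝ) {d : ℕ} (m : MLP d d) (η : ℝ) :
    Sym2 (Fin d → ℝ) → (Fin (d + d) → ℝ) :=
  Sym2.lift ⟨fun x y =>
      Fin.append ((x + η • m.eval σ x) + (y + η • m.eval σ y))
        (fun i => |(x + η • m.eval σ x) i - (y + η • m.eval σ y) i|),
    fun x y => by
      simp only [add_comm (x + η • m.eval σ x) (y + η • m.eval σ y), abs_sub_comm]⟩

/-- Weights of LGVR for node colourings with values in `ℝ^d`. -/
structure LGVRWeights (d : ℕ) where
  m : MLP d d
  η : ℝ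
  width : ℕ
  P₁ : GIN (d + d) width
  P₂ : GIN width 1

/-- The coloured line graph of `(G, c)`, refined by the GIN `P₁`. -/
noncomputable def LGVRWeights.lineColor (σ : ℝ → ℝ) {d : ℕ} (θ : LGVRWeights d) {V : Type}
    [Fintype V] (G : SimpleGraph V) (c : V → (Fin d → ℝ)) : G.edgeSet → (Fin θ.width → ℝ) :=
  open Classical in
  θ.P₁.eval σ G.lineGraph (fun e => phiMap σ θ.m θ.η (Sym2.map c e.1))

/-- The colours of the nodes of the line graph of the complete graph on `V`: the colouring
`lineColor`, extended by `0` to virtual edges, is passed through the GIN `P₂`, whose output is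
made `[0,1]`-valued by the logistic function. -/
noncomputable def LGVRWeights.edgeValue (σ : ℝ → ℝ) {d : ℕ} (θ : LGVRWeights d) {V : Type}
    [Fintype V] (G : SimpleGraph V) (c : V → (Fin d → ℝ)) :
    (⊤ : SimpleGraph V).edgeSet → ℝ :=
  open Classical in
  fun e => Real.sigmoid (θ.P₂.eval σ (⊤ : SimpleGraph V).lineGraph
    (fun f => if h : f.1 ∈ G.edgeSet then θ.lineColor σ G c ⟨f.1, h⟩ else 0) e 0)

/-- The edge filtration matrix. -/
noncomputable def LGVRWeights.filtrationMatrix (σ : ℝ → ℝ) {d : ℕ} (θ : LGVRWeights d) {V : Type}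
    [Fintype V] (G : SimpleGraph V) (c : V → (Fin d → ℝ)) (u v : V) : ℝ :=
  open Classical in
  if h : u = v then 0 else θ.edgeValue σ G c ⟨s(u, v), h⟩

/-- The LGVR diagram: the `0`-th and `1`-st persistence diagrams over the scales `[0, 1/2]`. -/
noncomputable def LGVRWeights.diagram (σ : ℝ → ℝ) {d : ℕ} (θ : LGVRWeights d) {V : Type}
    [Fintype V] (G : SimpleGraph V) (c : V → (Fin d → ℝ)) :
    Multiset (ℝ × WithTop ℝ) × Multiset (ℝ × WithTop ℝ) :=
  (persistenceDiagram 0 (θ.filtrationMatrix σ G c) (1 / 2),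
    persistenceDiagram 1 (θ.filtrationMatrix σ G c) (1 / 2))

/-- A point of a diagram as a vector in `ℝ²`. The death `⊤` is entered as `1`, the upper end of the
range of the edge values; finite deaths are at most `1/2`. -/
noncomputable def diagramPoint (p : ℝ × WithTop ℝ) : Fin 2 → ℝ := ![p.1, p.2.untopD 1]

/-- Weights of a set encoder with values in `ℝ^n` for pairs of persistence diagrams. -/
structure SetEncoder (n : ℕ) where
  w₀ : ℕ
  w₁ : ℕ
  S₀ : MLP 2 w₀
  S₁ : MLP 2 w₁
  m : MLP (w₀ + w₁) n

/-- `(D₀, D₁) ↦ m (∑_{p ∈ D₀} S₀(p), ∑_{p ∈ D₁} S₁(p))`. -/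
noncomputable def SetEncoder.eval (σ : ℝ → ℝ) {n : ℕ} (S : SetEncoder n)
    (D : Multiset (ℝ × WithTop ℝ) × Multiset (ℝ × WithTop ℝ)) : Fin n → ℝ :=
  S.m.eval σ (Fin.append ((D.1.map (fun p => S.S₀.eval σ (diagramPoint p))).sum)
    ((D.2.map (fun p => S.S₁.eval σ (diagramPoint p))).sum))

/-! ### The three models -/

/-- Weights of GIN-LGVR for features in `ℝ^N`; `d` is the dimension of the node colours and `out`
that of the graph representation. -/
structure GINLGVR (N : ℕ) where
  d : ℕ
  out : ℕ
  gin : GIN N d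
  lgvr : LGVRWeights d
  enc : SetEncoder out

/-- The GIN-LGVR representation of a graph: the encoded LGVR diagram of the GIN colouring. -/
noncomputable def GINLGVR.rep (σ : ℝ → ℝ) {N : ℕ} (θ : GINLGVR N) (G : FGraph N) :
    Fin θ.out → ℝ :=
  θ.enc.eval σ (θ.lgvr.diagram σ G.graph (θ.gin.eval σ G.graph G.feat))

/-- Weights of GIN-LGVR⁺. -/
structure GINLGVRPlus (N : ℕ) where
  d : ℕ
  gin : GIN N d
  lgvr : LGVRWeights d
  enc : SetEncoder d
  ε : ℝ

/-- The GIN-LGVR⁺ representation: the GIN-LGVR representation plus `(1 + ε)` times the sum of the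
GIN colours of all nodes. -/
noncomputable def GINLGVRPlus.rep (σ : ℝ → ℝ) {N : ℕ} (θ : GINLGVRPlus N) (G : FGraph N) :
    Fin θ.d → ℝ :=
  θ.enc.eval σ (θ.lgvr.diagram σ G.graph (θ.gin.eval σ G.graph G.feat)) +
    (1 + θ.ε) • ∑ u, θ.gin.eval σ G.graph G.feat u

/-- Weights of PPGN-LGVR⁺. -/
structure PPGNLGVRPlus (N : ℕ) where
  d : ℕ
  ppgn : PPGN (N + 2) d
  lgvr : LGVRWeights d
  enc : SetEncoder d
  ε : ℝ

/-- The node colouring extracted from PPGN: the diagonal of its output tensor. -/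
noncomputable def PPGNLGVRPlus.nodeColor (σ : ℝ → ℝ) {N : ℕ} (θ : PPGNLGVRPlus N)
    (G : FGraph N) (u : Fin G.order) : Fin θ.d → ℝ :=
  θ.ppgn.eval σ (ppgnInput G.graph G.feat) u u

/-- The PPGN-LGVR⁺ representation: the encoded LGVR diagram of the node colouring plus `(1 + ε)`
times the sum of the colours of all nodes. -/
noncomputable def PPGNLGVRPlus.rep (σ : ℝ → ℝ) {N : ℕ} (θ : PPGNLGVRPlus N) (G : FGraph N) :
    Fin θ.d → ℝ :=
  θ.enc.eval σ (θ.lgvr.diagram σ G.graph (θ.nodeColor σ G)) +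
    (1 + θ.ε) • ∑ u, θ.nodeColor σ G u

/-! ### Comparing a family of models with a test -/

/-- With suitable weights, the same for all graphs of the class `𝒢`, the model distinguishes all
pairs which the test distinguishes. -/
def AtLeastAsPowerful {N : ℕ} {Θ : Type} {out : Θ → ℕ}
    (rep : (θ : Θ) → FGraph N → (Fin (out θ) → ℝ)) (test : FGraph N → FGraph N → Prop)
    (𝒢 : Set (FGraph N)) : Prop :=
  ∃ θ : Θ, ∀ G ∈ 𝒢, ∀ H ∈ 𝒢, test G H → rep θ G ≠ rep θ H

/-- With suitable weights, the same for all graphs of the class `𝒢`, the model distinguishes all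
pairs which the test distinguishes, and also some pair which the test does not distinguish. -/
def StrictlyMorePowerful {N : ℕ} {Θ : Type} {out : Θ → ℕ}
    (rep : (θ : Θ) → FGraph N → (Fin (out θ) → ℝ)) (test : FGraph N → FGraph N → Prop)
    (𝒢 : Set (FGraph N)) : Prop :=
  ∃ θ : Θ, (∀ G ∈ 𝒢, ∀ H ∈ 𝒢, test G H → rep θ G ≠ rep θ H) ∧
    ∃ G ∈ 𝒢, ∃ H ∈ 𝒢, ¬ test G H ∧ rep θ G ≠ rep θ H

/-- The graphs with at most `n` nodes and with node features in `χ`. -/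
def boundedGraphs {N : ℕ} (χ : Set (Fin N → ℝ)) (n : ℕ) : Set (FGraph N) :=
  {G | G.order ≤ n ∧ ∀ v, G.feat v ∈ χ}

/-- No node is isolated. -/
def FGraph.NoIsolated {N : ℕ} (G : FGraph N) : Prop := ∀ v, ∃ u, G.graph.Adj v u

open Filter Topology

/-! ### Generic units of an analytic sigmoidal activation -/

/-! The proof rests on genericity of the weights and on the topology of weighted graphs.

Genericity. A class of graphs of bounded order with features in a countable set is countable, so
only countably many vectors, multisets and diagrams ever occur. A nontrivial linear combination of
the units `σ (t * x + s)` does not vanish identically in `(t, s)` (`linearIndependent_units`), and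
by analyticity its nontrivial restrictions to one parameter have countably many zeros. Countably
many such combinations can therefore be avoided simultaneously, even near a prescribed unit
(`exists_mlp_near`). Applied to differences of formal sums, this yields perceptrons whose sums over
finite multisets determine the multiset. Consequently a GIN layer loses nothing of a WL round, a
PPGN block loses nothing of a round of folklore two-dimensional refinement (which controls 3-WL),
the set encoder loses nothing of the diagrams, and a generic `ε` keeps the two summands of a
plus-model apart.

Topology. `P₁` can be tuned close to `1` on edges while virtual edges carry `0`, and `P₂` can turn
this into a sign. Thus the pairs with value at most `1/2` are exactly the edges, and their values
determine the colours of the endpoints. In a filtration by 1-skeleta each edge either merges two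
components (a death in degree 0) or closes a cycle (an essential class in degree 1), so the two
diagrams together count the edges of every value. As refined colours determine degrees, counting
edge ends of a colour and dividing by its degree recovers the number of non-isolated nodes of that
colour. The degree 0 diagram has as many points as there are nodes, hence also gives the number of
isolated nodes, but not their features. This is why GIN-LGVR is treated on classes where isolated
nodes share a feature or are absent, while GIN-LGVR⁺ reads all colours from the added sum.

Strictness comes from the hexagon and two triangles: both are 2-regular, so WL sees no difference,
but the numbers of essential components differ. -/

theorem AnalyticOnNhd.countable_zeros {f : ℝ → ℝ} (hf : AnalyticOnNhd ℝ f Set.univ)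
    (h : ∃ x, f x ≠ 0) : {x | f x = 0}.Countable := by
  have hd : DiscreteTopology {x | f x = 0} := by
    rw [discreteTopology_subtype_iff]
    intro x hx
    rcases (hf x (Set.mem_univ x)).eventually_eq_zero_or_eventually_ne_zero with h0 | h0
    · obtain ⟨y, hy⟩ := h
      exact absurd (hf.eqOn_zero_of_preconnected_of_eventuallyEq_zero isPreconnected_univ
        (Set.mem_univ x) h0 (Set.mem_univ y)) hy
    · rw [← Filter.empty_mem_iff_bot, Filter.mem_inf_principal]
      filter_upwards [h0] with y hy hy'
      exact hy hy'
  -- The zeros are isolated, and a discrete subspace of the line is separable, hence countable.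
  exact Set.countable_coe_iff.1 (TopologicalSpace.separableSpace_iff_countable.1 inferInstance)

theorem exists_between_notMem {C : Set ℝ} (hC : C.Countable) {a b : ℝ} (hab : a < b) :
    ∃ x ∉ C, a < x ∧ x < b :=
  (hC.dense_compl ℝ).exists_between hab

theorem exists_notMem_of_countable {C : Set ℝ} (hC : C.Countable) : ∃ x, x ∉ C :=
  let ⟨x, hx, _⟩ := exists_between_notMem hC zero_lt_one
  ⟨x, hx⟩

theorem IsAnalyticSigmoidal.continuous {σ : ℝ → ℝ} (hσ : IsAnalyticSigmoidal σ) :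
    Continuous σ :=
  continuousOn_univ.1 hσ.1.continuousOn

theorem IsAnalyticSigmoidal.bounded {σ : ℝ → ℝ} (hσ : IsAnalyticSigmoidal σ) :
    ∃ K > 0, ∀ x, |σ x| ≤ K := by
  obtain ⟨a, b, -, ha, hb⟩ := hσ.2
  have h1 : ∀ᶠ x in atBot, |σ x| < |a| + 1 := ha.abs.eventually_lt_const (by linarith)
  have h2 : ∀ᶠ x in atTop, |σ x| < |b| + 1 := hb.abs.eventually_lt_const (by linarith)
  obtain ⟨A, hA⟩ := eventually_atBot.1 h1
  obtain ⟨B, hB⟩ := eventually_atTop.1 h2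
  obtain ⟨K, hK⟩ := (isCompact_Icc (a := A) (b := B)).exists_bound_of_continuousOn
    hσ.continuous.continuousOn
  refine ⟨|a| + 1 + (|b| + 1) + |K|, by positivity, fun x => ?_⟩
  have := abs_nonneg a
  have := abs_nonneg b
  have := abs_nonneg K
  rcases le_total x A with h | h
  · linarith [hA x h]
  rcases le_total B x with h' | h'
  · linarith [hB x h']
  · have := hK x ⟨h, h'⟩
    rw [Real.norm_eq_abs] at this
    linarith [le_abs_self K]

theorem IsAnalyticSigmoidal.exists_ne {σ : ℝ → ℝ} (hσ : IsAnalyticSigmoidal σ) :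
    ∃ x y, σ x ≠ σ y := by
  by_contra! h
  obtain ⟨a, b, hab, ha, hb⟩ := hσ.2
  have hc : σ = fun _ => σ 0 := funext fun x => h x 0
  rw [hc] at ha hb
  exact hab ((tendsto_nhds_unique ha tendsto_const_nhds).trans
    (tendsto_nhds_unique hb tendsto_const_nhds).symm)

/-- Let `x₀` be the largest point of the support and replace the shift by `s - t * x₀`. As `t → ∞`
the unit at `x₀` stays `σ s`, while the units at smaller points tend to the limit `a` at `-∞`. If
all combinations vanished, then `c x₀ * σ s` would not depend on `s`, so `σ` would be constant. -/
theorem IsAnalyticSigmoidal.linearIndependent_units {σ : ℝ → ℝ} (hσ : IsAnalyticSigmoidal σ)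
    {c : ℝ →₀ ℝ} (hc : c ≠ 0) :
    ∃ t s, Finsupp.linearCombination ℝ (fun x => σ (t * x + s)) c ≠ 0 := by
  by_contra! h
  obtain ⟨a, b, hab, ha, hb⟩ := hσ.2
  have hne : c.support.Nonempty := Finsupp.support_nonempty_iff.2 hc
  set x₀ := c.support.max' hne with hx₀
  have hmem : x₀ ∈ c.support := c.support.max'_mem hne
  have key : ∀ s, ∑ x ∈ c.support, (if x = x₀ then c x * σ s else c x * a) = 0 := by
    intro s
    have hlim : Tendsto (fun t : ℝ => ∑ x ∈ c.support, c x * σ (t * x + (s - t * x₀))) atTop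
        (𝓝 (∑ x ∈ c.support, (if x = x₀ then c x * σ s else c x * a))) := by
      refine tendsto_finsetSum _ fun x hx => ?_
      split_ifs with hxx
      · subst hxx
        simp only [add_sub_cancel]
        exact tendsto_const_nhds
      · have hlt : x - x₀ < 0 := sub_neg.2 (lt_of_le_of_ne (c.support.le_max' x hx) hxx)
        refine Tendsto.const_mul _ (ha.comp ?_)
        have : (fun t : ℝ => t * x + (s - t * x₀)) = fun t => t * (x - x₀) + s := by
          ext t; ring
        rw [this]
        exact tendsto_atBot_add_const_right _ _ (tendsto_id.atTop_mul_const_of_neg hlt)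
    refine tendsto_nhds_unique hlim ?_
    have : ∀ t : ℝ, ∑ x ∈ c.support, c x * σ (t * x + (s - t * x₀)) = 0 := fun t => by
      have := h t (s - t * x₀)
      rwa [Finsupp.linearCombination_apply, Finsupp.sum] at this
    simp only [this]
    exact tendsto_const_nhds
  have hconst : ∀ s, σ s = σ 0 := by
    intro s
    have h1 := key s
    have h2 := key 0
    rw [← Finset.add_sum_erase _ _ hmem] at h1 h2
    rw [if_pos rfl] at h1 h2
    have : ∀ r, ∑ x ∈ c.support.erase x₀, (if x = x₀ then c x * σ r else c x * a) =
        ∑ x ∈ c.support.erase x₀, c x * a := fun r =>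
      Finset.sum_congr rfl fun x hx => if_neg (Finset.ne_of_mem_erase hx)
    rw [this] at h1 h2
    have hne0 : c x₀ ≠ 0 := Finsupp.mem_support_iff.1 hmem
    exact mul_left_cancel₀ hne0 (by linarith)
  obtain ⟨x, y, hxy⟩ := hσ.exists_ne
  exact hxy ((hconst x).trans (hconst y).symm)

theorem IsAnalyticSigmoidal.analytic_units {σ : ℝ → ℝ} (hσ : IsAnalyticSigmoidal σ)
    (c : ℝ →₀ ℝ) (p q : ℝ → ℝ → ℝ) (hp : ∀ x, AnalyticOnNhd ℝ (p x) Set.univ)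
    (hq : ∀ x r, p x r = q x r) :
    AnalyticOnNhd ℝ (fun r => Finsupp.linearCombination ℝ (fun x => σ (q x r)) c) Set.univ := by
  simp only [Finsupp.linearCombination_apply, Finsupp.sum, smul_eq_mul, ← hq]
  refine Finset.analyticOnNhd_fun_sum _ fun x _ => analyticOnNhd_const.mul ?_
  exact hσ.1.comp (hp x) (fun _ _ => Set.mem_univ _)

/-- Zero sets in the plane of parameters need not be countable, so the parameters are fixed one at a
time. For each `c` the shift is first frozen at a good value `S c`, which leaves countably many bad
`t`; once `t` is chosen, only countably many `s` are bad. -/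
theorem IsAnalyticSigmoidal.exists_unit_real {σ : ℝ → ℝ} (hσ : IsAnalyticSigmoidal σ)
    {C : Set (ℝ →₀ ℝ)} (hC : C.Countable) (h0 : ∀ c ∈ C, c ≠ 0) :
    ∃ t s, ∀ c ∈ C, Finsupp.linearCombination ℝ (fun x => σ (t * x + s)) c ≠ 0 := by
  choose! T S hTS using fun c hc => hσ.linearIndependent_units (h0 c hc)
  obtain ⟨t, ht⟩ := exists_notMem_of_countable (hC.biUnion fun c hc =>
    (hσ.analytic_units c (fun x t => t * x + S c) _
      (fun x => (analyticOnNhd_id.mul analyticOnNhd_const).add analyticOnNhd_const)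
      (fun _ _ => rfl)).countable_zeros ⟨T c, hTS c hc⟩)
  simp only [Set.mem_iUnion, Set.mem_ofPred_eq, not_exists] at ht
  obtain ⟨s, hs⟩ := exists_notMem_of_countable (hC.biUnion fun c hc =>
    (hσ.analytic_units c (fun x s => t * x + s) _
      (fun x => analyticOnNhd_const.add analyticOnNhd_id)
      (fun _ _ => rfl)).countable_zeros ⟨S c, ht c hc⟩)
  simp only [Set.mem_iUnion, Set.mem_ofPred_eq, not_exists] at hs
  exact ⟨t, s, hs⟩

/-- The polynomial whose coefficients are the entries of a vector. -/
noncomputable def vectorPolynomial {m : ℕ} (x : Fin m → ℝ) : Polynomial ℝ :=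
  ∑ i : Fin m, Polynomial.C (x i) * Polynomial.X ^ (i : ℕ)

theorem vectorPolynomial_eq_zero {m : ℕ} {x : Fin m → ℝ} (hx : vectorPolynomial x = 0) :
    x = 0 := by
  ext i
  have h : (vectorPolynomial x).coeff i = 0 := by rw [hx, Polynomial.coeff_zero]
  rw [vectorPolynomial, Polynomial.finsetSum_coeff, Finset.sum_eq_single i] at h
  · rwa [Polynomial.coeff_C_mul, Polynomial.coeff_X_pow, if_pos rfl, mul_one] at h
  · intro j _ hj
    rw [Polynomial.coeff_C_mul, Polynomial.coeff_X_pow, if_neg (fun h => hj (Fin.ext h.symm)),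
      mul_zero]
  · simp

theorem eval_vectorPolynomial {m : ℕ} (x : Fin m → ℝ) (r : ℝ) :
    (vectorPolynomial x).eval r = (fun i : Fin m => r ^ (i : ℕ)) ⬝ᵥ x := by
  rw [vectorPolynomial, Polynomial.eval_finsetSum, dotProduct]
  refine Finset.sum_congr rfl fun i _ => ?_
  rw [Polynomial.eval_mul, Polynomial.eval_C, Polynomial.eval_pow, Polynomial.eval_X, mul_comm]

/-- A linear form which is injective on a countable set. -/
theorem exists_dotProduct_injOn {m : ℕ} {S : Set (Fin m → ℝ)} (hS : S.Countable) :
    ∃ w : Fin m → ℝ, Set.InjOn (fun x => w ⬝ᵥ x) S := by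
  have hcount : (⋃ p ∈ S ×ˢ S, {r : ℝ | vectorPolynomial (p.1 - p.2) ≠ 0 ∧
      (vectorPolynomial (p.1 - p.2)).eval r = 0}).Countable := by
    refine (hS.prod hS).biUnion fun p _ => ?_
    by_cases h : vectorPolynomial (p.1 - p.2) = 0
    · simp [h]
    · refine Set.Countable.mono (fun r hr => ?_)
        (vectorPolynomial (p.1 - p.2)).roots.toFinset.countable_toSet
      simpa [h] using hr.2
  obtain ⟨r, hr⟩ := exists_notMem_of_countable hcount
  -- The form is a point of the moment curve: its value at `x - y` is the value at `r` of a nonzero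
  -- polynomial, so each pair of distinct points excludes finitely many `r`.
  refine ⟨fun i => r ^ (i : ℕ), fun x hx y hy hxy => ?_⟩
  by_contra hne
  refine hr (Set.mem_biUnion (show (x, y) ∈ S ×ˢ S from ⟨hx, hy⟩)
    ⟨fun h => hne (sub_eq_zero.1 (vectorPolynomial_eq_zero h)), ?_⟩)
  rw [eval_vectorPolynomial, dotProduct_sub]
  exact sub_eq_zero.2 hxy

theorem Finsupp.mapDomain_ne_zero {α β : Type*} {c : α →₀ ℝ} {f : α → β}
    (hf : Set.InjOn f c.support) (hc : c ≠ 0) : Finsupp.mapDomain f c ≠ 0 := by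
  intro h
  refine hc (Finsupp.mapDomain_injOn (M := ℝ) (c.support : Set α) hf ?_ ?_ ?_)
  · exact subset_refl (c.support : Set α)
  · simp
  · simpa using h

/-- Pushing the combinations forward along a linear form that is injective on all supports keeps
them nonzero and reduces the claim to the real line. -/
theorem IsAnalyticSigmoidal.exists_unit {σ : ℝ → ℝ} (hσ : IsAnalyticSigmoidal σ) {m : ℕ}
    {C : Set ((Fin m → ℝ) →₀ ℝ)} (hC : C.Countable) (h0 : ∀ c ∈ C, c ≠ 0) :
    ∃ (w : Fin m → ℝ) (s : ℝ),
      ∀ c ∈ C, Finsupp.linearCombination ℝ (fun x => σ (w ⬝ᵥ x + s)) c ≠ 0 := by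
  obtain ⟨w, hw⟩ := exists_dotProduct_injOn (hC.biUnion fun c _ => c.support.countable_toSet)
  obtain ⟨t, s, hts⟩ := hσ.exists_unit_real (hC.image (Finsupp.mapDomain fun x => w ⬝ᵥ x)) (by
    rintro _ ⟨c, hc, rfl⟩
    exact Finsupp.mapDomain_ne_zero (hw.mono fun x hx => Set.mem_biUnion hc hx) (h0 c hc))
  refine ⟨t • w, s, fun c hc => ?_⟩
  have := hts _ ⟨c, hc, rfl⟩
  rw [Finsupp.linearCombination_mapDomain] at this
  simpa [Function.comp_def, smul_dotProduct] using this

/-- A perceptron with two hidden units and scalar output. -/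
def MLP.twoUnits {m : ℕ} (β : ℝ) (w : Fin m → ℝ) (s b δ : ℝ) (w' : Fin m → ℝ) (s' : ℝ) : MLP m 1 :=
  .shallow ![w, w'] ![s, s'] ![![β, δ]] ![b]

theorem MLP.twoUnits_eval (σ : ℝ → ℝ) {m : ℕ} (β : ℝ) (w : Fin m → ℝ) (s b δ : ℝ)
    (w' : Fin m → ℝ) (s' : ℝ) (x : Fin m → ℝ) :
    (MLP.twoUnits β w s b δ w' s').eval σ x 0 =
      β * σ (w ⬝ᵥ x + s) + b + δ * σ (w' ⬝ᵥ x + s') := by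
  simp [MLP.twoUnits, MLP.eval, Matrix.mulVec, dotProduct, Fin.sum_univ_two]
  ring

/-- A perceptron close to a given unit which does not annihilate any of countably many nonzero
combinations of points. -/
theorem IsAnalyticSigmoidal.exists_mlp_near {σ : ℝ → ℝ} (hσ : IsAnalyticSigmoidal σ) {m : ℕ}
    {C : Set ((Fin m → ℝ) →₀ ℝ)} (hC : C.Countable) (h0 : ∀ c ∈ C, c ≠ 0)
    (β : ℝ) (w : Fin m → ℝ) (s b : ℝ) {η : ℝ} (hη : 0 < η) :
    ∃ g : MLP m 1, (∀ x, |g.eval σ x 0 - (β * σ (w ⬝ᵥ x + s) + b)| < η) ∧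
      ∀ c ∈ C, Finsupp.linearCombination ℝ (fun x => g.eval σ x 0) c ≠ 0 := by
  obtain ⟨w', s', h'⟩ := hσ.exists_unit hC h0
  obtain ⟨K, hK, hb⟩ := hσ.bounded
  let F := fun c : (Fin m → ℝ) →₀ ℝ =>
    Finsupp.linearCombination ℝ (fun x => β * σ (w ⬝ᵥ x + s) + b) c
  let H := fun c : (Fin m → ℝ) →₀ ℝ => Finsupp.linearCombination ℝ (fun x => σ (w' ⬝ᵥ x + s')) c
  -- A generic unit with small coefficient `δ` is added to the given one. Since `H c ≠ 0`, the sum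
  -- `F c + δ * H c` vanishes for a single `δ`, and `δ < η / K` keeps the perturbation below `η`.
  obtain ⟨δ, hδ, hδ0, hδ1⟩ := exists_between_notMem (hC.image fun c => -F c / H c)
    (show (0 : ℝ) < η / K by positivity)
  refine ⟨MLP.twoUnits β w s b δ w' s', fun x => ?_, fun c hc h => hδ ⟨c, hc, ?_⟩⟩
  · rw [MLP.twoUnits_eval, add_sub_cancel_left, abs_mul, abs_of_pos hδ0]
    calc δ * |σ (w' ⬝ᵥ x + s')| ≤ δ * K := by gcongr; exact hb _
      _ < η := (lt_div_iff₀ hK).1 hδ1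
  · have hs : Finsupp.linearCombination ℝ
        (fun x => (MLP.twoUnits β w s b δ w' s').eval σ x 0) c = F c + δ * H c := by
      simp only [F, H, MLP.twoUnits_eval, Finsupp.linearCombination_apply, Finsupp.sum,
        smul_eq_mul, Finset.mul_sum, ← Finset.sum_add_distrib]
      exact Finset.sum_congr rfl fun x _ => by ring
    rw [hs] at h
    have hH : H c ≠ 0 := h' c hc
    simp only
    rw [div_eq_iff hH]
    linarith

/-! ### Functions which are injective on finite multisets after summation -/

/-- Sums of values of `f` over finite multisets of points of `S` determine the multiset. -/
def SumInjOn {α E : Type*} [AddCommMonoid E] (f : α → E) (S : Set α) : Prop :=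
  ∀ M M' : Multiset α, (∀ x ∈ M, x ∈ S) → (∀ x ∈ M', x ∈ S) →
    (M.map f).sum = (M'.map f).sum → M = M'

theorem SumInjOn.injOn {α E : Type*} [AddCommMonoid E] {f : α → E} {S : Set α}
    (h : SumInjOn f S) : Set.InjOn f S := fun x hx y hy hxy =>
  Multiset.singleton_inj.1 (h {x} {y} (by simpa) (by simpa) (by simpa))

theorem countable_multisets {α : Type*} {S : Set α} (hS : S.Countable) :
    {M : Multiset α | ∀ x ∈ M, x ∈ S}.Countable := by
  have := hS.to_subtype
  refine (Set.countable_range fun M : Multiset S => M.map Subtype.val).mono fun M hM => ?_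
  exact ⟨M.attach.map fun x => ⟨x.1, hM x.1 x.2⟩, by simp [Multiset.map_map]⟩

/-- The formal sum of a multiset. -/
noncomputable def formalSum {α : Type*} (M : Multiset α) : α →₀ ℝ :=
  (M.map fun x => Finsupp.single x 1).sum

theorem formalSum_injective {α : Type*} : Function.Injective (formalSum (α := α)) := by
  classical
  have h : ∀ (M : Multiset α) x, formalSum M x = M.count x := by
    intro M x
    induction M using Multiset.induction_on with
    | empty => simp [formalSum]
    | cons a M ih =>
      simp only [formalSum, Multiset.map_cons, Multiset.sum_cons, Finsupp.add_apply,
        Multiset.count_cons] at ih ⊢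
      rw [ih, Finsupp.single_apply]
      by_cases hx : a = x
      · subst hx; simp [add_comm]
      · simp [hx, Ne.symm hx]
  intro M M' hMM
  ext x
  have := h M x
  rw [hMM, h M' x] at this
  exact_mod_cast this.symm

theorem linearCombination_formalSum {α : Type*} (f : α → ℝ) (M : Multiset α) :
    Finsupp.linearCombination ℝ f (formalSum M) = (M.map f).sum := by
  rw [formalSum, map_multiset_sum, Multiset.map_map]
  simp

/-- The differences of the formal sums of two distinct multisets of points of `S`. -/
def multisetDifferences {α : Type*} (S : Set α) : Set (α →₀ ℝ) :=
  {c | c ≠ 0 ∧ ∃ M M' : Multiset α, (∀ x ∈ M, x ∈ S) ∧ (∀ x ∈ M', x ∈ S) ∧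
    c = formalSum M - formalSum M'}

theorem countable_multisetDifferences {α : Type*} {S : Set α} (hS : S.Countable) :
    (multisetDifferences S).Countable := by
  refine (((countable_multisets hS).prod (countable_multisets hS)).image
    fun p => formalSum p.1 - formalSum p.2).mono ?_
  rintro c ⟨-, M, M', hM, hM', rfl⟩
  exact ⟨(M, M'), ⟨hM, hM'⟩, rfl⟩

/-- Injectivity on multisets is turned into the non-vanishing of countably many nonzero linear
combinations, the condition that generic perceptrons satisfy. -/
theorem multiset_eq_of_differences {α : Type*} {S : Set α} {f : α → ℝ}
    (h : ∀ c ∈ multisetDifferences S, Finsupp.linearCombination ℝ f c ≠ 0)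
    {M M' : Multiset α} (hM : ∀ x ∈ M, x ∈ S) (hM' : ∀ x ∈ M', x ∈ S)
    (hs : (M.map f).sum = (M'.map f).sum) : M = M' := by
  by_contra hne
  refine h (formalSum M - formalSum M')
    ⟨fun h => hne (formalSum_injective (sub_eq_zero.1 h)), M, M', hM, hM', rfl⟩ ?_
  rw [map_sub, linearCombination_formalSum, linearCombination_formalSum, hs, sub_self]

theorem sum_map_apply {α ι : Type*} (f : α → ι → ℝ) (M : Multiset α) (i : ι) :
    (M.map f).sum i = (M.map fun x => f x i).sum := by
  simpa [Multiset.map_map, Function.comp_def] using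
    map_multiset_sum (Pi.evalAddMonoidHom (fun _ : ι => ℝ) i) (M.map f)

theorem IsAnalyticSigmoidal.exists_mlp_sumInjOn_near {σ : ℝ → ℝ} (hσ : IsAnalyticSigmoidal σ)
    {m : ℕ} {S : Set (Fin m → ℝ)} (hS : S.Countable) (β : ℝ) (w : Fin m → ℝ) (s b : ℝ) {η : ℝ}
    (hη : 0 < η) :
    ∃ g : MLP m 1, (∀ x, |g.eval σ x 0 - (β * σ (w ⬝ᵥ x + s) + b)| < η) ∧
      SumInjOn (g.eval σ) S := by
  obtain ⟨g, hg, h⟩ := hσ.exists_mlp_near (countable_multisetDifferences hS) (fun c hc => hc.1)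
    β w s b hη
  refine ⟨g, hg, fun M M' hM hM' hs => multiset_eq_of_differences h hM hM' ?_⟩
  have := congrFun hs 0
  rwa [sum_map_apply, sum_map_apply] at this

theorem IsAnalyticSigmoidal.exists_mlp_sumInjOn {σ : ℝ → ℝ} (hσ : IsAnalyticSigmoidal σ)
    {m : ℕ} {S : Set (Fin m → ℝ)} (hS : S.Countable) :
    ∃ g : MLP m 1, SumInjOn (g.eval σ) S :=
  let ⟨g, _, h⟩ := hσ.exists_mlp_sumInjOn_near hS 0 0 0 0 one_pos
  ⟨g, h⟩

/-! ### Colour refinement -/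

/-- Equality of the images under `f` and `f'` is a matching of the two multisets along which these
functions agree; the same matching serves for `g` and `g'`. This is the device for passing from
finer to coarser colour histograms. -/
theorem Multiset.map_eq_map_of_determines {α β γ δ : Type*} {M : Multiset α} {M' : Multiset β}
    {f : α → γ} {f' : β → γ} {g : α → δ} {g' : β → δ}
    (h : ∀ a ∈ M, ∀ b ∈ M', f a = f' b → g a = g' b) (hM : M.map f = M'.map f') :
    M.map g = M'.map g' := by
  rw [← Multiset.rel_eq, Multiset.rel_map] at hM ⊢
  exact hM.mono h

/-- A sequence of colourings of a finite type, each of which refines its predecessor and which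
is stationary as soon as a colouring is as coarse as its predecessor, is stationary after as many
steps as there are pairs. -/
theorem colouring_stable {X : Type} [Fintype X] {C : ℕ → Type} (c : ∀ t, X → C t)
    (hmono : ∀ t x y, c (t + 1) x = c (t + 1) y → c t x = c t y)
    (hstep : ∀ t, (∀ x y, c t x = c t y → c (t + 1) x = c (t + 1) y) →
      ∀ x y, c (t + 1) x = c (t + 1) y → c (t + 2) x = c (t + 2) y)
    {T : ℕ} (hT : Fintype.card X ^ 2 ≤ T) (t : ℕ) (x y : X) (h : c T x = c T y) :
    c t x = c t y := by
  classical
  have hmono' : ∀ {s s'}, s ≤ s' → ∀ x y, c s' x = c s' y → c s x = c s y := by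
    intro s s' hs
    induction s', hs using Nat.le_induction with
    | base => exact fun _ _ h => h
    | succ s' _ ih => exact fun x y h => ih x y (hmono s' x y h)
  let E : ℕ → Finset (X × X) := fun t => Finset.univ.filter fun p => c t p.1 = c t p.2
  have hE : ∃ s ≤ Fintype.card X ^ 2, ∀ x y, c s x = c s y → c (s + 1) x = c (s + 1) y := by
    by_contra! hne
    -- Without a stationary step every round would remove a pair from `E`, which starts with at most
    -- `Fintype.card X ^ 2` elements.
    have hcard : ∀ s ≤ Fintype.card X ^ 2 + 1, (E s).card + s ≤ Fintype.card X ^ 2 := by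
      intro s
      induction s with
      | zero =>
        intro _
        calc (E 0).card + 0 ≤ (Finset.univ : Finset (X × X)).card := Finset.card_filter_le _ _
          _ = Fintype.card X ^ 2 := by rw [Finset.card_univ, Fintype.card_prod, sq]
      | succ s ih =>
        intro hs
        obtain ⟨x, y, h1, h2⟩ := hne s (by omega)
        have hlt : (E (s + 1)).card < (E s).card := by
          refine Finset.card_lt_card (Finset.ssubset_iff_subset_ne.2 ⟨fun p hp => ?_, fun h => h2 ?_⟩)
          · simp only [E, Finset.mem_filter, Finset.mem_univ, true_and] at hp ⊢
            exact hmono s _ _ hp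
          · have : (x, y) ∈ E s := by simpa [E] using h1
            rw [← h] at this
            simpa [E] using this
        have := ih (by omega)
        omega
    have := hcard _ le_rfl
    omega
  obtain ⟨s, hs, hst⟩ := hE
  have hstab : ∀ k, ∀ x y, c (s + k) x = c (s + k) y → c (s + k + 1) x = c (s + k + 1) y := by
    intro k
    induction k with
    | zero => exact hst
    | succ k ih => exact hstep _ ih
  have hall : ∀ k, ∀ x y, c s x = c s y → c (s + k) x = c (s + k) y := by
    intro k
    induction k with
    | zero => exact fun _ _ h => h
    | succ k ih => exact fun x y h => hstab k x y (ih x y h)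
  rcases le_total t T with htT | htT
  · exact hmono' htT x y h
  · obtain ⟨k, rfl⟩ := Nat.exists_eq_add_of_le ((hs.trans hT).trans htT)
    exact hall k x y (hmono' (hs.trans hT) x y h)

section WL

variable {V V' X Y : Type} [Fintype V] [Fintype V'] {G : SimpleGraph V} {G' : SimpleGraph V'}

open Classical in
/-- The neighbours of a node, as a multiset. -/
noncomputable def nbrs {V : Type} [Fintype V] (G : SimpleGraph V) (v : V) : Multiset V :=
  (Finset.univ.filter (fun u => G.Adj v u)).val

theorem mem_nbrs {u v : V} : u ∈ nbrs G v ↔ G.Adj v u := by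
  simp [nbrs]

theorem wlColor_succ (x : V → X) (t : ℕ) (v : V) :
    wlColor G x (t + 1) v = (wlColor G x t v, (nbrs G v).map (wlColor G x t)) := rfl

theorem wlColor_succ_eq_iff {x : V → X} {x' : V' → X} {t : ℕ} {u : V} {v : V'} :
    wlColor G x (t + 1) u = wlColor G' x' (t + 1) v ↔
      wlColor G x t u = wlColor G' x' t v ∧
        (nbrs G u).map (wlColor G x t) = (nbrs G' v).map (wlColor G' x' t) := by
  rw [wlColor_succ, wlColor_succ]
  exact Prod.mk_inj

/-- Allows the rounds to be split: if a recolouring `y` already knows the `s`-th colours of `x`,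
then `t` rounds started from `y` know the colours of round `s + t`. For a network, `y` is the output
of its first layer. -/
theorem wlColor_determines {x : V → X} {x' : V' → X} {y : V → Y} {y' : V' → Y} {s : ℕ}
    (h : ∀ u v, y u = y' v → wlColor G x s u = wlColor G' x' s v) (t : ℕ) (u : V) (v : V')
    (huv : wlColor G y t u = wlColor G' y' t v) :
    wlColor G x (s + t) u = wlColor G' x' (s + t) v := by
  induction t generalizing u v with
  | zero => exact h u v huv
  | succ t ih =>
    rw [wlColor_succ_eq_iff] at huv
    exact wlColor_succ_eq_iff.2 ⟨ih u v huv.1,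
      Multiset.map_eq_map_of_determines (fun a _ b _ => ih a b) huv.2⟩

theorem wlColor_stable_step {x : V → X} {x' : V' → X} {t : ℕ}
    (h : ∀ u v, wlColor G x t u = wlColor G' x' t v → wlColor G x (t + 1) u = wlColor G' x' (t + 1) v)
    (u : V) (v : V') (huv : wlColor G x (t + 1) u = wlColor G' x' (t + 1) v) :
    wlColor G x (t + 2) u = wlColor G' x' (t + 2) v :=
  wlColor_succ_eq_iff.2 ⟨huv,
    Multiset.map_eq_map_of_determines (fun a _ b _ => h a b) (wlColor_succ_eq_iff.1 huv).2⟩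

/-- Stabilisation is applied to both graphs jointly, on `V ⊕ V'`, because equality of colours across
the two graphs has to persist as well. -/
theorem wlColor_stable (x : V → X) (x' : V' → X) {T : ℕ}
    (hT : (Fintype.card V + Fintype.card V') ^ 2 ≤ T) (t : ℕ) (u : V) (v : V')
    (h : wlColor G x T u = wlColor G' x' T v) : wlColor G x t u = wlColor G' x' t v := by
  refine colouring_stable (X := V ⊕ V') (fun t => Sum.elim (wlColor G x t) (wlColor G' x' t))
    ?_ ?_ (by rwa [Fintype.card_sum]) t (.inl u) (.inr v) h
  · rintro t (a | a) (b | b) h <;> exact (wlColor_succ_eq_iff.1 h).1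
  · rintro t h (a | a) (b | b)
    · exact wlColor_stable_step (fun u v => h (.inl u) (.inl v)) a b
    · exact wlColor_stable_step (fun u v => h (.inl u) (.inr v)) a b
    · exact wlColor_stable_step (fun u v => h (.inr u) (.inl v)) a b
    · exact wlColor_stable_step (fun u v => h (.inr u) (.inr v)) a b

theorem wlColor_eq_of_isolated {x : V → X} {x' : V' → X} {u : V} {v : V'} (hu : ∀ w, ¬ G.Adj u w)
    (hv : ∀ w, ¬ G'.Adj v w) (h : x u = x' v) (t : ℕ) :
    wlColor G x t u = wlColor G' x' t v := by
  have h1 : nbrs G u = 0 := Multiset.eq_zero_of_forall_notMem fun w hw => hu w (mem_nbrs.1 hw)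
  have h2 : nbrs G' v = 0 := Multiset.eq_zero_of_forall_notMem fun w hw => hv w (mem_nbrs.1 hw)
  induction t with
  | zero => exact h
  | succ t ih => exact wlColor_succ_eq_iff.2 ⟨ih, by rw [h1, h2, Multiset.map_zero, Multiset.map_zero]⟩

theorem wlColor_eq_of_regular {x : V → X} {x' : V' → X} {d : ℕ} (hG : ∀ u, (nbrs G u).card = d)
    (hG' : ∀ u, (nbrs G' u).card = d) (h : ∀ u v, x u = x' v) (t : ℕ) (u : V) (v : V') :
    wlColor G x t u = wlColor G' x' t v := by
  induction t generalizing u v with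
  | zero => exact h u v
  | succ t ih =>
    refine wlColor_succ_eq_iff.2 ⟨ih u v, ?_⟩
    refine Multiset.map_eq_map_of_determines (f := fun _ => ()) (f' := fun _ => ())
      (fun a _ b _ _ => ih a b) ?_
    rw [Multiset.map_const', Multiset.map_const', hG, hG']

theorem not_wlDistinguishes {N : ℕ} {G H : FGraph N} {T : ℕ} (hT : (G.order + H.order) ^ 2 ≤ T)
    (h : (Finset.univ : Finset (Fin G.order)).val.map (wlColor G.graph G.feat T) =
      (Finset.univ : Finset (Fin H.order)).val.map (wlColor H.graph H.feat T)) :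
    ¬ WLDistinguishes G H := by
  rintro ⟨t, ht⟩
  exact ht (Multiset.map_eq_map_of_determines
    (fun a _ b _ => wlColor_stable _ _ (by simpa using hT) t a b) h)

end WL

/-! ### Graph isomorphism networks -/

/-- Restates sum-injectivity as a property of the values alone. In this form it is the invariant
passed from one layer to the next. -/
theorem SumInjOn.image {α E : Type*} [AddCommMonoid E] {f : α → E} {S : Set α}
    (h : SumInjOn f S) : SumInjOn id (f '' S) := by
  have lift : ∀ M : Multiset E, (∀ x ∈ M, x ∈ f '' S) →
      ∃ M₀ : Multiset α, (∀ x ∈ M₀, x ∈ S) ∧ M₀.map f = M := by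
    intro M
    induction M using Multiset.induction_on with
    | empty => exact fun _ => ⟨0, by simp, by simp⟩
    | cons a M ih =>
      intro hM
      obtain ⟨M₀, h0, rfl⟩ := ih fun x hx => hM x (Multiset.mem_cons_of_mem hx)
      obtain ⟨y, hy, rfl⟩ := hM a (Multiset.mem_cons_self _ _)
      exact ⟨y ::ₘ M₀, by simpa [hy] using h0, by simp⟩
  intro M M' hM hM' hs
  obtain ⟨M₀, h0, rfl⟩ := lift M hM
  obtain ⟨M₁, h1, rfl⟩ := lift M' hM'
  rw [h M₀ M₁ h0 h1 (by simpa using hs)]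

section GIN

variable {I : Type} {V : I → Type}

/-- All values of a family of functions. -/
def allValues {α : Type} (x : ∀ i, V i → α) : Set α := Set.range fun p : Σ i, V i => x p.1 p.2

theorem mem_allValues {α : Type} (x : ∀ i, V i → α) (i : I) (v : V i) : x i v ∈ allValues x :=
  ⟨⟨i, v⟩, rfl⟩

theorem map_eq_map_of_sum_eq {E : Type} [AddCommMonoid E] {x : ∀ i, V i → E}
    (hx : SumInjOn id (allValues x)) {i j : I} {M : Multiset (V i)} {M' : Multiset (V j)}
    (h : (M.map (x i)).sum = (M'.map (x j)).sum) : M.map (x i) = M'.map (x j) := by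
  refine hx _ _ (fun y hy => ?_) (fun y hy => ?_) (by simpa using h) <;>
  · obtain ⟨w, -, rfl⟩ := Multiset.mem_map.1 hy
    exact mem_allValues x _ w

theorem countable_allValues [Countable I] [∀ i, Fintype (V i)] {α : Type} (x : ∀ i, V i → α) : (allValues x).Countable :=
  Set.countable_range _

theorem allValues_comp {α β : Type} (x : ∀ i, V i → α) (f : α → β) :
    allValues (fun i v => f (x i v)) = f '' allValues x := by
  rw [allValues, allValues, ← Set.range_comp]
  rfl

theorem ginAggregate_eq {V : Type} [Fintype V] (G : SimpleGraph V) {a : ℕ} (ε : ℝ)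
    (x : V → (Fin a → ℝ)) (v : V) :
    ginAggregate G ε x v = (1 + ε) • x v + ((nbrs G v).map x).sum := rfl

variable [Countable I] [∀ i, Fintype (V i)]

/-- For generic `ε`, an aggregation determines the old colour of the node and the sum of the
colours of the neighbours. -/
theorem exists_eps_ginAggregate (G : ∀ i, SimpleGraph (V i)) {a : ℕ} (x : ∀ i, V i → (Fin a → ℝ))
    (l : ℝ) :
    ∃ ε, l < 1 + ε ∧ ∀ i j u v, ginAggregate (G i) ε (x i) u = ginAggregate (G j) ε (x j) v →
      x i u = x j v ∧ ((nbrs (G i) u).map (x i)).sum = ((nbrs (G j) v).map (x j)).sum := by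
  let S : (Σ i, V i) → (Fin a → ℝ) := fun p => ((nbrs (G p.1) p.2).map (x p.1)).sum
  -- If the old colours of two nodes differ in coordinate `q.2`, equality of the aggregations
  -- determines `1 + ε` as the quotient below. Countably many values are excluded from the interval
  -- `(l - 1, l)`.
  obtain ⟨ε, hε, hl, -⟩ := exists_between_notMem (Set.countable_range
    fun q : ((Σ i, V i) × (Σ i, V i)) × Fin a =>
      (S q.1.2 q.2 - S q.1.1 q.2) / (x q.1.1.1 q.1.1.2 q.2 - x q.1.2.1 q.1.2.2 q.2) - 1)
    (lt_add_one (l - 1))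
  refine ⟨ε, by linarith, fun i j u v h => ?_⟩
  rw [ginAggregate_eq, ginAggregate_eq] at h
  have hx : x i u = x j v := by
    by_contra hne
    obtain ⟨k, hk⟩ := Function.ne_iff.1 hne
    refine hε ⟨((⟨i, u⟩, ⟨j, v⟩), k), ?_⟩
    have hk' := sub_ne_zero.2 hk
    have := congrFun h k
    simp only [Pi.add_apply, Pi.smul_apply, smul_eq_mul] at this
    simp only [S]
    rw [sub_eq_iff_eq_add, div_eq_iff hk']
    linarith
  rw [hx] at h
  exact ⟨hx, add_left_cancel h⟩

/-- With a generic `ε` the aggregation separates a node's colour from the sum over its neighbours,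
and sum-injectivity of the input values turns that sum into the multiset. The perceptron restores
sum-injectivity for the next layer. Since a network has at least one layer, `T + 1` layers give `T +
1` rounds. -/
theorem IsAnalyticSigmoidal.exists_ginLayers {σ : ℝ → ℝ} (hσ : IsAnalyticSigmoidal σ)
    (G : ∀ i, SimpleGraph (V i)) (T : ℕ) (x : ∀ i, V i → (Fin 1 → ℝ))
    (hx : SumInjOn id (allValues x)) :
    ∃ L : GINLayers 1 1, SumInjOn id (allValues fun i => L.eval σ (G i) (x i)) ∧
      ∀ i j u v, L.eval σ (G i) (x i) u = L.eval σ (G j) (x j) v →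
        wlColor (G i) (x i) (T + 1) u = wlColor (G j) (x j) (T + 1) v := by
  induction T generalizing x with
  | zero =>
    obtain ⟨ε, -, hε⟩ := exists_eps_ginAggregate G x 0
    obtain ⟨g, hg⟩ := hσ.exists_mlp_sumInjOn
      (countable_allValues fun i => ginAggregate (G i) ε (x i))
    refine ⟨.one ε g, ?_, fun i j u v h => ?_⟩
    · exact (allValues_comp (fun i => ginAggregate (G i) ε (x i)) (g.eval σ)) ▸ hg.image
    · obtain ⟨h1, h2⟩ := hε i j u v (hg.injOn (mem_allValues _ i u) (mem_allValues _ j v) h)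
      exact wlColor_succ_eq_iff.2 ⟨h1, map_eq_map_of_sum_eq hx h2⟩
  | succ T ih =>
    obtain ⟨ε, -, hε⟩ := exists_eps_ginAggregate G x 0
    obtain ⟨g, hg⟩ := hσ.exists_mlp_sumInjOn
      (countable_allValues fun i => ginAggregate (G i) ε (x i))
    obtain ⟨L, hL, hLwl⟩ := ih (fun i v => g.eval σ (ginAggregate (G i) ε (x i) v))
      ((allValues_comp (fun i => ginAggregate (G i) ε (x i)) (g.eval σ)) ▸ hg.image)
    refine ⟨.cons ε g L, hL, fun i j u v h => ?_⟩
    have := wlColor_determines (x := x i) (x' := x j) (s := 1) (fun u v h => ?_) (T + 1) u v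
      (hLwl i j u v h)
    · rwa [add_comm] at this
    · obtain ⟨h1, h2⟩ := hε i j u v (hg.injOn (mem_allValues _ i u) (mem_allValues _ j v) h)
      exact wlColor_succ_eq_iff.2 ⟨h1, map_eq_map_of_sum_eq hx h2⟩

/-- A graph isomorphism network which refines `T` rounds of colour refinement. -/
theorem IsAnalyticSigmoidal.exists_gin {σ : ℝ → ℝ} (hσ : IsAnalyticSigmoidal σ)
    (G : ∀ i, SimpleGraph (V i)) (T : ℕ) {a : ℕ} (x : ∀ i, V i → (Fin a → ℝ)) :
    ∃ L : GIN a 1, SumInjOn id (allValues fun i => L.eval σ (G i) (x i)) ∧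
      ∀ i j u v, L.eval σ (G i) (x i) u = L.eval σ (G j) (x j) v →
        wlColor (G i) (x i) (T + 1) u = wlColor (G j) (x j) (T + 1) v := by
  obtain ⟨g, hg⟩ := hσ.exists_mlp_sumInjOn (countable_allValues x)
  obtain ⟨L, hL, hLwl⟩ := hσ.exists_ginLayers G T (fun i v => g.eval σ (x i v))
    ((allValues_comp x (g.eval σ)) ▸ hg.image)
  refine ⟨⟨1, g, L⟩, hL, fun i j u v h => ?_⟩
  -- The initial perceptron merely recolours injectively, so it accounts for no round: `s = 0`.
  have := wlColor_determines (x := x i) (x' := x j) (s := 0)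
    (fun u v h => hg.injOn (mem_allValues x i u) (mem_allValues x j v) h) (T + 1) u v
    (hLwl i j u v h)
  rwa [zero_add] at this

end GIN

/-! ### Provably expressive networks and the three-dimensional test -/

/-- Fubini for finite sums: `g` is applied to each row of the coefficient matrix, then `f` to the
resulting column. -/
theorem linearCombination_mul {α β : Type*} (f : α → ℝ) (g : β → ℝ) (c : α × β →₀ ℝ) :
    Finsupp.linearCombination ℝ (fun p : α × β => f p.1 * g p.2) c =
      Finsupp.linearCombination ℝ f
        (c.curry.mapRange (Finsupp.linearCombination ℝ g) (map_zero _)) := by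
  rw [Finsupp.linearCombination_apply, Finsupp.linearCombination_apply,
    Finsupp.sum_mapRange_index (by simp),
    ← Finsupp.sum_curry_index c (fun x y a => a • (f x * g y))]
  refine Finsupp.sum_congr fun x _ => ?_
  rw [Finsupp.linearCombination_apply, Finsupp.sum, Finsupp.sum, Finset.sum_smul]
  refine Finset.sum_congr rfl fun y _ => ?_
  simp only [smul_eq_mul]
  ring

/-- Two perceptrons such that sums of products of their values determine multisets of pairs. -/
theorem IsAnalyticSigmoidal.exists_mlp_mul_sumInjOn {σ : ℝ → ℝ} (hσ : IsAnalyticSigmoidal σ)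
    {a : ℕ} {S : Set (Fin a → ℝ)} (hS : S.Countable) :
    ∃ m₁ m₂ : MLP a 1, SumInjOn
      (fun p : (Fin a → ℝ) × (Fin a → ℝ) => m₁.eval σ p.1 0 * m₂.eval σ p.2 0) (S ×ˢ S) := by
  have hC := countable_multisetDifferences (hS.prod hS)
  -- `m₂` is chosen first, so that it annihilates no nonzero row of any difference. The columns
  -- obtained this way are nonzero, and `m₁` is generic for them.
  obtain ⟨m₂, -, h₂⟩ := hσ.exists_mlp_near
    (C := ⋃ c ∈ multisetDifferences (S ×ˢ S), c.curry '' (c.curry.support : Set _))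
    (hC.biUnion fun c _ => (Finset.countable_toSet _).image _) (by
      intro d hd
      simp only [Set.mem_iUnion, Set.mem_image] at hd
      obtain ⟨c, -, x, hx, rfl⟩ := hd
      exact Finsupp.mem_support_iff.1 hx) 0 0 0 0 one_pos
  obtain ⟨m₁, -, h₁⟩ := hσ.exists_mlp_near
    (hC.image fun c => c.curry.mapRange
      (Finsupp.linearCombination ℝ fun x => m₂.eval σ x 0) (map_zero _)) (by
      rintro _ ⟨c, hc, rfl⟩ h
      have hne : c.curry ≠ 0 := fun h0 => hc.1 (by
        ext p
        have := congrArg (fun f => f p.1 p.2) h0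
        simpa [Finsupp.curry_apply] using this)
      obtain ⟨x, hx⟩ := Finsupp.ne_iff.1 hne
      refine h₂ (c.curry x) (Set.mem_biUnion hc ⟨x, Finsupp.mem_support_iff.2 hx, rfl⟩) ?_
      have := DFunLike.congr_fun h x
      simpa using this) 0 0 0 0 one_pos
  refine ⟨m₁, m₂, fun M M' hM hM' hs => multiset_eq_of_differences (fun c hc => ?_) hM hM' hs⟩
  have := h₁ _ ⟨c, hc, rfl⟩
  rwa [← linearCombination_mul] at this

/-- Colours after `t` rounds of the folklore two-dimensional refinement. -/
def FolkloreColor (X : Type) : ℕ → Type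
  | 0 => X
  | t + 1 => FolkloreColor X t × Multiset (FolkloreColor X t × FolkloreColor X t)

/-- The folklore two-dimensional refinement of a colouring of pairs of nodes. -/
noncomputable def folkloreColor {V X : Type} [Fintype V] (y : V → V → X) :
    (t : ℕ) → V → V → FolkloreColor X t
  | 0 => y
  | t + 1 => fun u v => (folkloreColor y t u v, (Finset.univ : Finset V).val.map
      fun w => (folkloreColor y t u w, folkloreColor y t w v))

section Input

variable {V V' : Type} {N : ℕ} {G : SimpleGraph V} {G' : SimpleGraph V'} {x : V → (Fin N → ℝ)}
  {x' : V' → (Fin N → ℝ)}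

theorem ppgnInput_eq_iff {u v : V} {u' v' : V'}
    (h : ppgnInput G x u v = ppgnInput G' x' u' v') :
    (u = v ↔ u' = v') ∧ (G.Adj u v ↔ G'.Adj u' v') ∧ (u = v → x u = x' u') := by
  have h1 : (u = v ↔ u' = v') := by
    have := congrFun h (Fin.natAdd N 1)
    simp only [ppgnInput, Fin.append_right] at this
    by_cases h1 : u = v <;> by_cases h2 : u' = v' <;> simp_all
  refine ⟨h1, ?_, fun huv => ?_⟩
  · have := congrFun h (Fin.natAdd N 0)
    simp only [ppgnInput, Fin.append_right] at this
    by_cases h1 : G.Adj u v <;> by_cases h2 : G'.Adj u' v' <;> simp_all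
  · ext i
    have := congrFun h (Fin.castAdd 2 i)
    simpa only [ppgnInput, Fin.append_left, if_pos huv, if_pos (h1.1 huv)] using this

theorem ppgnInput_symm (u v : V) : ppgnInput G x u v = ppgnInput G x v u := by
  by_cases h : u = v
  · rw [h]
  · by_cases h1 : G.Adj u v
    · simp only [ppgnInput, h, Ne.symm h, if_false, h1, h1.symm]
    · simp only [ppgnInput, h, Ne.symm h, if_false, h1, mt SimpleGraph.Adj.symm h1]

end Input

/-! ### Folklore two-dimensional refinement controls 3-WL -/

section Folklore

variable {V V' X Y : Type} [Fintype V] [Fintype V']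

theorem folkloreColor_succ_eq_iff {y : V → V → X} {y' : V' → V' → X} {t : ℕ} {u v : V}
    {u' v' : V'} :
    folkloreColor y (t + 1) u v = folkloreColor y' (t + 1) u' v' ↔
      folkloreColor y t u v = folkloreColor y' t u' v' ∧
        (Finset.univ : Finset V).val.map
            (fun w => (folkloreColor y t u w, folkloreColor y t w v)) =
          (Finset.univ : Finset V').val.map
            (fun w => (folkloreColor y' t u' w, folkloreColor y' t w v')) :=
  Prod.mk_inj

theorem folkloreColor_determines {x : V → V → X} {x' : V' → V' → X} {y : V → V → Y}
    {y' : V' → V' → Y} {s : ℕ}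
    (h : ∀ u v u' v', y u v = y' u' v' → folkloreColor x s u v = folkloreColor x' s u' v')
    (t : ℕ) (u v : V) (u' v' : V')
    (huv : folkloreColor y t u v = folkloreColor y' t u' v') :
    folkloreColor x (s + t) u v = folkloreColor x' (s + t) u' v' := by
  induction t generalizing u v u' v' with
  | zero => exact h u v u' v' huv
  | succ t ih =>
    rw [folkloreColor_succ_eq_iff] at huv
    refine folkloreColor_succ_eq_iff.2 ⟨ih _ _ _ _ huv.1,
      Multiset.map_eq_map_of_determines (fun a _ b _ hab => ?_) huv.2⟩
    rw [Prod.mk_inj] at hab ⊢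
    exact ⟨ih _ _ _ _ hab.1, ih _ _ _ _ hab.2⟩

theorem folkloreColor_zero_eq {y : V → V → X} {y' : V' → V' → X} {t : ℕ} {u v : V} {u' v' : V'}
    (h : folkloreColor y t u v = folkloreColor y' t u' v') : y u v = y' u' v' := by
  induction t with
  | zero => exact h
  | succ t ih => exact ih (folkloreColor_succ_eq_iff.1 h).1

/-- Reversing a pair exchanges the two components of every entry in its multiset, so symmetry of the
initial colouring propagates through the rounds. -/
theorem folkloreColor_swap {y : V → V → X} {y' : V' → V' → X} (hy : ∀ u v, y u v = y v u)
    (hy' : ∀ u v, y' u v = y' v u) (t : ℕ) {u v : V} {u' v' : V'}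
    (h : folkloreColor y t u v = folkloreColor y' t u' v') :
    folkloreColor y t v u = folkloreColor y' t v' u' := by
  induction t generalizing u v u' v' with
  | zero => exact (hy v u).trans (Eq.trans h (hy' u' v'))
  | succ t ih =>
    rw [folkloreColor_succ_eq_iff] at h ⊢
    refine ⟨ih h.1, Multiset.map_eq_map_of_determines (fun a _ b _ hab => ?_) h.2⟩
    rw [Prod.mk_inj] at hab ⊢
    exact ⟨ih hab.2, ih hab.1⟩

theorem kwlColor_succ_eq_iff {k : ℕ} {G : SimpleGraph V} {G' : SimpleGraph V'} {x : V → X}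
    {x' : V' → X} {t : ℕ} {p : Fin k → V} {q : Fin k → V'} :
    kwlColor k G x (t + 1) p = kwlColor k G' x' (t + 1) q ↔
      kwlColor k G x t p = kwlColor k G' x' t q ∧ ∀ j,
        (Finset.univ : Finset V).val.map (fun u => kwlColor k G x t (Function.update p j u)) =
        (Finset.univ : Finset V').val.map
          (fun u => kwlColor k G' x' t (Function.update q j u)) :=
  Prod.mk_inj.trans (and_congr_right fun _ => funext_iff)

theorem kwlColor_stable_step {k : ℕ} {G : SimpleGraph V} {G' : SimpleGraph V'} {x : V → X}
    {x' : V' → X} {t : ℕ} (h : ∀ p q, kwlColor k G x t p = kwlColor k G' x' t q →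
      kwlColor k G x (t + 1) p = kwlColor k G' x' (t + 1) q) (p : Fin k → V) (q : Fin k → V')
    (hpq : kwlColor k G x (t + 1) p = kwlColor k G' x' (t + 1) q) :
    kwlColor k G x (t + 2) p = kwlColor k G' x' (t + 2) q :=
  kwlColor_succ_eq_iff.2 ⟨hpq, fun j => Multiset.map_eq_map_of_determines (fun _ _ _ _ => h _ _)
    ((kwlColor_succ_eq_iff.1 hpq).2 j)⟩

theorem kwlColor_stable {k : ℕ} {G : SimpleGraph V} {G' : SimpleGraph V'} (x : V → X)
    (x' : V' → X) {T : ℕ} (hT : (Fintype.card V ^ k + Fintype.card V' ^ k) ^ 2 ≤ T) (t : ℕ)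
    (p : Fin k → V) (q : Fin k → V') (h : kwlColor k G x T p = kwlColor k G' x' T q) :
    kwlColor k G x t p = kwlColor k G' x' t q := by
  refine colouring_stable (X := (Fin k → V) ⊕ (Fin k → V'))
    (fun t => Sum.elim (kwlColor k G x t) (kwlColor k G' x' t))
    ?_ ?_ (by simpa [Fintype.card_sum] using hT) t (.inl p) (.inr q) h
  · rintro t (a | a) (b | b) h <;> exact (kwlColor_succ_eq_iff.1 h).1
  · rintro t h (a | a) (b | b)
    · exact kwlColor_stable_step (fun u v => h (.inl u) (.inl v)) a b
    · exact kwlColor_stable_step (fun u v => h (.inl u) (.inr v)) a b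
    · exact kwlColor_stable_step (fun u v => h (.inr u) (.inl v)) a b
    · exact kwlColor_stable_step (fun u v => h (.inr u) (.inr v)) a b

theorem not_kwlDistinguishes {N k : ℕ} {G H : FGraph N} {T : ℕ}
    (hT : (G.order ^ k + H.order ^ k) ^ 2 ≤ T)
    (h : (Finset.univ : Finset (Fin k → Fin G.order)).val.map (kwlColor k G.graph G.feat T) =
      (Finset.univ : Finset (Fin k → Fin H.order)).val.map (kwlColor k H.graph H.feat T)) :
    ¬ KWLDistinguishes k G H := by
  rintro ⟨t, ht⟩
  exact ht (Multiset.map_eq_map_of_determines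
    (fun a _ b _ => kwlColor_stable _ _ (by simpa using hT) t a b) h)

variable {N : ℕ} {G : SimpleGraph V} {G' : SimpleGraph V'} {x : V → (Fin N → ℝ)}
  {x' : V' → (Fin N → ℝ)}

/-- The multiset of `(u, v)` contains the entry for `w = u`, whose first component is the diagonal
colour. The identity channel recognises diagonal pairs, so the matching entry on the other side also
comes from `w = u'`. -/
theorem folkloreColor_diag {t : ℕ} {u v : V} {u' v' : V'}
    (h : folkloreColor (ppgnInput G x) (t + 1) u v = folkloreColor (ppgnInput G' x') (t + 1) u' v') :
    folkloreColor (ppgnInput G x) t u u = folkloreColor (ppgnInput G' x') t u' u' := by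
  have hm : (folkloreColor (ppgnInput G x) t u u, folkloreColor (ppgnInput G x) t u v) ∈
      (Finset.univ : Finset V).val.map (fun w =>
        (folkloreColor (ppgnInput G x) t u w, folkloreColor (ppgnInput G x) t w v)) :=
    Multiset.mem_map.2 ⟨u, Finset.mem_univ_val _, rfl⟩
  rw [(folkloreColor_succ_eq_iff.1 h).2] at hm
  obtain ⟨w, -, hw⟩ := Multiset.mem_map.1 hm
  have hw1 := (Prod.mk_inj.1 hw).1
  have := ((ppgnInput_eq_iff (folkloreColor_zero_eq hw1)).1).2 rfl
  rw [← hw1, ← this]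

/-- Replacing entry `j` of a triple by `w` leaves the other two entries `p a`, `p b`, and the
folklore multiset of that pair lists the colours of `(p a, w)` and `(w, p b)` jointly; these are all
the new pairs up to reversal. The additional round is needed at the start, where the features must
be read off the diagonal. -/
theorem kwlColor_eq_of_folkloreColor (t : ℕ) (p : Fin 3 → V) (q : Fin 3 → V')
    (h : ∀ i j, i ≠ j → folkloreColor (ppgnInput G x) (t + 1) (p i) (p j) =
      folkloreColor (ppgnInput G' x') (t + 1) (q i) (q j)) :
    kwlColor 3 G x t p = kwlColor 3 G' x' t q := by
  induction t generalizing p q with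
  | zero =>
    have h0 : ∀ i j, i ≠ j → ppgnInput G x (p i) (p j) = ppgnInput G' x' (q i) (q j) :=
      fun i j hij => folkloreColor_zero_eq (h i j hij)
    refine Prod.mk_inj.2 ⟨funext fun i => ?_, Prod.mk_inj.2 ⟨?_, ?_⟩⟩
    · obtain ⟨j, hj⟩ := exists_ne i
      exact (ppgnInput_eq_iff (folkloreColor_zero_eq (folkloreColor_diag (h i j hj.symm)))).2.2 rfl
    · ext i j
      by_cases hij : i = j
      · simp [hij]
      · exact (ppgnInput_eq_iff (h0 i j hij)).1
    · ext i j
      by_cases hij : i = j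
      · simp [hij]
      · exact (ppgnInput_eq_iff (h0 i j hij)).2.1
  | succ t ih =>
    have hpred : ∀ i j, i ≠ j → folkloreColor (ppgnInput G x) (t + 1) (p i) (p j) =
        folkloreColor (ppgnInput G' x') (t + 1) (q i) (q j) :=
      fun i j hij => (folkloreColor_succ_eq_iff.1 (h i j hij)).1
    refine kwlColor_succ_eq_iff.2 ⟨ih p q hpred, fun j => ?_⟩
    obtain ⟨a, b, ha, hb, hab, hall⟩ :
        ∃ a b : Fin 3, a ≠ j ∧ b ≠ j ∧ a ≠ b ∧ ∀ i, i = j ∨ i = a ∨ i = b := by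
      revert j; decide
    refine Multiset.map_eq_map_of_determines (fun w _ w' _ hw => ih _ _ fun i k hik => ?_)
      (folkloreColor_succ_eq_iff.1 (h a b hab)).2
    obtain ⟨h1, h2⟩ := Prod.mk_inj.1 hw
    have h1' := folkloreColor_swap ppgnInput_symm ppgnInput_symm _ h1
    have h2' := folkloreColor_swap ppgnInput_symm ppgnInput_symm _ h2
    rcases hall i with rfl | rfl | rfl <;> rcases hall k with rfl | rfl | rfl <;>
      simp_all [Function.update_of_ne]

theorem map_univ_eq_sum {α β : Type*} [Fintype α] (f : α → β) :
    (Finset.univ : Finset α).val.map f = ∑ a, {f a} := by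
  have := Multiset.sum_map_singleton ((Finset.univ : Finset α).val.map f)
  rw [Multiset.map_map] at this
  exact this.symm

/-- Triples of nodes as functions on `Fin 3`. -/
def tripleEquiv (V : Type*) : V × V × V ≃ (Fin 3 → V) where
  toFun p := ![p.1, p.2.1, p.2.2]
  invFun f := (f 0, f 1, f 2)
  left_inv _ := rfl
  right_inv f := by ext i; fin_cases i <;> rfl

theorem map_univ_triples {β : Type*} (f : (Fin 3 → V) → β) :
    (Finset.univ : Finset (Fin 3 → V)).val.map f = ∑ u, ∑ v, ∑ w, {f ![u, v, w]} := by
  rw [map_univ_eq_sum, ← (tripleEquiv V).sum_comp, Fintype.sum_prod_type]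
  refine Finset.sum_congr rfl fun u _ => ?_
  rw [Fintype.sum_prod_type]
  rfl

theorem sum_eq_sum_of_determines {γ δ : Type*} [AddCommMonoid δ] {f : V → γ} {f' : V' → γ}
    {g : V → δ} {g' : V' → δ} (h : ∀ a b, f a = f' b → g a = g' b)
    (hf : (Finset.univ : Finset V).val.map f = (Finset.univ : Finset V').val.map f') :
    ∑ a, g a = ∑ b, g' b :=
  congrArg Multiset.sum (Multiset.map_eq_map_of_determines (fun a _ b _ => h a b) hf)

/-- The histogram over triples is an iterated sum of singletons. Diagonal colours match `u`, one
unfolding matches `v`, another matches `w`; together with the additional round of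
`kwlColor_eq_of_folkloreColor` this uses three rounds. -/
theorem map_kwlColor_eq_of_folkloreColor (t : ℕ)
    (h : (Finset.univ : Finset V).val.map (fun u => folkloreColor (ppgnInput G x) (t + 3) u u) =
      (Finset.univ : Finset V').val.map (fun u => folkloreColor (ppgnInput G' x') (t + 3) u u)) :
    (Finset.univ : Finset (Fin 3 → V)).val.map (kwlColor 3 G x t) =
      (Finset.univ : Finset (Fin 3 → V')).val.map (kwlColor 3 G' x' t) := by
  rw [map_univ_triples, map_univ_triples]
  refine sum_eq_sum_of_determines (fun u u' hu => ?_) h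
  refine sum_eq_sum_of_determines (fun v v' hv => ?_) (folkloreColor_succ_eq_iff.1 hu).2
  have hv := (Prod.mk_inj.1 hv).1
  refine sum_eq_sum_of_determines (fun w w' hw => ?_) (folkloreColor_succ_eq_iff.1 hv).2
  have huv := (folkloreColor_succ_eq_iff.1 hv).1
  obtain ⟨h1, h2⟩ := Prod.mk_inj.1 hw
  have h1' := folkloreColor_swap ppgnInput_symm ppgnInput_symm _ h1
  have h2' := folkloreColor_swap ppgnInput_symm ppgnInput_symm _ h2
  have huv' := folkloreColor_swap ppgnInput_symm ppgnInput_symm _ huv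
  rw [Multiset.singleton_inj]
  refine kwlColor_eq_of_folkloreColor t _ _ fun i j hij => ?_
  fin_cases i <;> fin_cases j <;> first | exact absurd rfl hij | assumption

end Folklore

/-! ### PPGN blocks as rounds of folklore refinement -/

section PPGN

variable {I : Type} [Countable I] {V : I → Type} [∀ i, Fintype (V i)]

/-- The direct path `m₃` remembers the old colour, and the matrix product is a sum over `w` of
products of values at `(u, w)` and `(w, v)`, which determines the multiset of pairs. Sum-injectivity
of `m₃` also makes the diagonal sum a faithful readout. -/
theorem IsAnalyticSigmoidal.exists_ppgnBlock {σ : ℝ → ℝ} (hσ : IsAnalyticSigmoidal σ) {a : ℕ}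
    (Y : ∀ i, V i → V i → (Fin a → ℝ)) :
    ∃ B : PPGNBlock a 1 1,
      (∀ i j u v u' v', B.eval σ (Y i) u v = B.eval σ (Y j) u' v' →
        folkloreColor (Y i) 1 u v = folkloreColor (Y j) 1 u' v') ∧
      ∀ i j, ∑ u, B.eval σ (Y i) u u = ∑ u, B.eval σ (Y j) u u →
        (Finset.univ : Finset (V i)).val.map (fun u => Y i u u) =
          (Finset.univ : Finset (V j)).val.map (fun u => Y j u u) := by
  let S : Set (Fin a → ℝ) := allValues (V := fun i => V i × V i) fun i p => Y i p.1 p.2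
  have hS : S.Countable := countable_allValues _
  have hmem : ∀ i u v, Y i u v ∈ S := fun i u v =>
    mem_allValues (V := fun i => V i × V i) (fun i p => Y i p.1 p.2) i (u, v)
  obtain ⟨m₁, m₂, hm⟩ := hσ.exists_mlp_mul_sumInjOn hS
  obtain ⟨m₃, hm₃⟩ := hσ.exists_mlp_sumInjOn hS
  refine ⟨⟨m₁, m₂, m₃⟩, fun i j u v u' v' h => ?_, fun i j h => ?_⟩
  · refine folkloreColor_succ_eq_iff.2 ⟨hm₃.injOn (hmem _ _ _) (hmem _ _ _) ?_,
      hm _ _ ?_ ?_ ?_⟩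
    · ext k
      have := congrFun h (Fin.castAdd 1 k)
      simp only [PPGNBlock.eval, Fin.append_left] at this
      exact this
    · intro p hp
      obtain ⟨w, -, rfl⟩ := Multiset.mem_map.1 hp
      exact ⟨hmem _ _ _, hmem _ _ _⟩
    · intro p hp
      obtain ⟨w, -, rfl⟩ := Multiset.mem_map.1 hp
      exact ⟨hmem _ _ _, hmem _ _ _⟩
    · have := congrFun h (Fin.natAdd 1 0)
      simp only [PPGNBlock.eval, Fin.append_right] at this
      erw [Multiset.map_map, Multiset.map_map]
      exact this
  · refine hm₃ _ _ ?_ ?_ ?_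
    · intro p hp
      obtain ⟨w, -, rfl⟩ := Multiset.mem_map.1 hp
      exact hmem _ _ _
    · intro p hp
      obtain ⟨w, -, rfl⟩ := Multiset.mem_map.1 hp
      exact hmem _ _ _
    · rw [Multiset.map_map, Multiset.map_map]
      ext k
      have := congrFun h (Fin.castAdd 1 k)
      simp only [Finset.sum_apply, PPGNBlock.eval, Fin.append_left] at this
      rw [sum_map_apply, sum_map_apply]
      exact this

/-- `T` blocks perform the rounds, and one more block provides the readout by diagonal sums. -/
theorem IsAnalyticSigmoidal.exists_ppgn {σ : ℝ → ℝ} (hσ : IsAnalyticSigmoidal σ) (T : ℕ) {a : ℕ}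
    (Y : ∀ i, V i → V i → (Fin a → ℝ)) :
    ∃ P : PPGN a (1 + 1), ∀ i j, ∑ u, P.eval σ (Y i) u u = ∑ u, P.eval σ (Y j) u u →
      (Finset.univ : Finset (V i)).val.map (fun u => folkloreColor (Y i) T u u) =
        (Finset.univ : Finset (V j)).val.map (fun u => folkloreColor (Y j) T u u) := by
  induction T generalizing a with
  | zero =>
    obtain ⟨B, -, hB⟩ := hσ.exists_ppgnBlock Y
    exact ⟨.one B, hB⟩
  | succ T ih =>
    obtain ⟨B, hB, -⟩ := hσ.exists_ppgnBlock Y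
    obtain ⟨P, hP⟩ := ih fun i => B.eval σ (Y i)
    refine ⟨.cons B P, fun i j h => ?_⟩
    rw [add_comm T 1]
    exact Multiset.map_eq_map_of_determines
      (fun u _ u' _ => folkloreColor_determines (hB i j) T u u u' u') (hP i j h)

end PPGN

/-! ### Persistence diagrams of one-skeleta -/

theorem Submodule.finrank_map_add_finrank_inf_ker {F U W : Type*} [Field F] [AddCommGroup U]
    [Module F U] [AddCommGroup W] [Module F W] [FiniteDimensional F U] (S : Submodule F U)
    (f : U →ₗ[F] W) :
    Module.finrank F (S.map f) + Module.finrank F (S ⊓ LinearMap.ker f : Submodule F U) =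
      Module.finrank F S := by
  rw [← LinearMap.finrank_range_add_finrank_ker (f.domRestrict S), LinearMap.range_domRestrict,
    LinearMap.ker_domRestrict, ← Submodule.finrank_map_subtype_eq, Submodule.map_comap_subtype]

section Persistence

variable {V : Type} {M : V → V → ℝ} {I J : Set ℝ}

/-- The one-skeleton of the Vietoris-Rips complex. -/
def vrSkeleton (M : V → V → ℝ) (I : Set ℝ) : PreAbstractSimplicialComplex V :=
  skeleton 1 (vrComplex M I)

theorem mem_vrSkeleton {s : Finset V} : s ∈ (vrSkeleton M I).faces ↔
    (s.Nonempty ∧ ∀ u ∈ s, ∀ v ∈ s, M u v ∈ I) ∧ s.card ≤ 2 := Iff.rfl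

theorem vrSkeleton_mono (h : I ⊆ J) : (vrSkeleton M I).faces ⊆ (vrSkeleton M J).faces :=
  fun _ hs => ⟨⟨hs.1.1, fun u hu v hv => h (hs.1.2 u hu v hv)⟩, hs.2⟩

/-- The rank of the boundary operator from edges to points. -/
noncomputable def boundaryRank (M : V → V → ℝ) (I : Set ℝ) : ℕ :=
  Module.finrank (ZMod 2) (simplicialBoundaries (ZMod 2) 0 (vrSkeleton M I))

/-- The number of edges. -/
noncomputable def edgeCount (M : V → V → ℝ) (I : Set ℝ) : ℕ :=
  Module.finrank (ZMod 2) (simplicialChains (ZMod 2) 1 (vrSkeleton M I))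

/-- The dimension of the cycle space. -/
noncomputable def cycleRank (M : V → V → ℝ) (I : Set ℝ) : ℕ :=
  Module.finrank (ZMod 2) (simplicialCycles (ZMod 2) 1 (vrSkeleton M I))

theorem vrSkeleton_congr (h : ∀ u v, M u v ∈ I ↔ M u v ∈ J) : vrSkeleton M I = vrSkeleton M J := by
  ext s
  simp only [mem_vrSkeleton, h]

theorem simplicialChains_mono (n : ℕ) (h : I ⊆ J) :
    simplicialChains (ZMod 2) n (vrSkeleton M I) ≤ simplicialChains (ZMod 2) n (vrSkeleton M J) :=
  Finsupp.supported_mono fun _ hs => ⟨vrSkeleton_mono h hs.1, hs.2⟩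

theorem boundaries_le_singletons :
    simplicialBoundaries (ZMod 2) 0 (vrSkeleton M J) ≤
      Finsupp.supported (ZMod 2) (ZMod 2) {s : Finset V | s.card = 1} := by
  classical
  rw [simplicialBoundaries, simplicialChains, Finsupp.supported_eq_span_single, Submodule.map_span,
    Submodule.span_le]
  rintro _ ⟨_, ⟨s, hs, rfl⟩, rfl⟩
  rw [simplicialBoundary, Finsupp.linearCombination_single, one_smul]
  refine Submodule.sum_mem _ fun v hv => Finsupp.single_mem_supported _ _ ?_
  have := hs.2
  simp [Finset.card_erase_of_mem hv, this]

/-- A face contains a vertex `v`, which forces `M v v = 0` to lie in `I`; below scale `0` the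
complex is empty. -/
theorem simplicialChains_eq_bot (hM : ∀ u, M u u = 0) (hI : (0 : ℝ) ∉ I) (n : ℕ) :
    simplicialChains (ZMod 2) n (vrSkeleton M I) = ⊥ := by
  have : {s | s ∈ (vrSkeleton M I).faces ∧ s.card = n + 1} = ∅ := by
    ext s
    simp only [mem_vrSkeleton, Set.mem_ofPred_eq, Set.mem_empty_iff_false, iff_false]
    rintro ⟨⟨⟨⟨v, hv⟩, h⟩, _⟩, _⟩
    exact hI (hM v ▸ h v hv v hv)
  rw [simplicialChains, this, Finsupp.supported_empty]

theorem boundaryRank_congr (h : ∀ u v, M u v ∈ I ↔ M u v ∈ J) :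
    boundaryRank M I = boundaryRank M J := by
  rw [boundaryRank, boundaryRank, vrSkeleton_congr h]

theorem vrBetti_zero_eq_zero (hM : ∀ u, M u u = 0) (hI : (0 : ℝ) ∉ I) : vrBetti 0 M I J = 0 := by
  change (Module.finrank (ZMod 2) (Submodule.map
    (simplicialBoundaries (ZMod 2) 0 (vrSkeleton M J)).mkQ
    (simplicialCycles (ZMod 2) 0 (vrSkeleton M I))) : ℤ) = _
  rw [simplicialCycles, if_pos rfl, simplicialChains_eq_bot hM hI, Submodule.map_bot, finrank_bot,
    Nat.cast_zero]

theorem boundaryRank_Iic_zero (hpos : ∀ u v, u ≠ v → 0 < M u v) :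
    boundaryRank M (Set.Iic 0) = 0 := by
  have : {s | s ∈ (vrSkeleton M (Set.Iic 0)).faces ∧ s.card = 0 + 1 + 1} = ∅ := by
    ext s
    simp only [mem_vrSkeleton, Set.mem_ofPred_eq, Set.mem_empty_iff_false, iff_false]
    rintro ⟨⟨⟨-, h⟩, -⟩, h2⟩
    obtain ⟨a, ha, b, hb, hab⟩ := Finset.one_lt_card.1 (show 1 < s.card by omega)
    exact absurd (h a ha b hb) (not_le.2 (hpos a b hab))
  rw [boundaryRank, simplicialBoundaries, simplicialChains, this, Finsupp.supported_empty,
    Submodule.map_bot, finrank_bot]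

/-- The chain of a point. -/
noncomputable def pointChain (v : V) : Finset V →₀ ZMod 2 := Finsupp.single {v} 1

theorem pointChain_add_self (v : V) : pointChain v + pointChain v = 0 := by
  rw [pointChain, ← Finsupp.single_add, CharTwo.add_self_eq_zero, Finsupp.single_zero]

theorem simplicialBoundary_pair [DecidableEq V] {u v : V} (h : u ≠ v) :
    simplicialBoundary (ZMod 2) V (Finsupp.single {u, v} 1) = pointChain u + pointChain v := by
  rw [simplicialBoundary, Finsupp.linearCombination_single, one_smul]
  have h1 : ({u, v} : Finset V).erase u = {v} := by
    ext x; simp only [Finset.mem_erase, Finset.mem_insert, Finset.mem_singleton]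
    constructor
    · tauto
    · rintro rfl; exact ⟨h.symm, Or.inr rfl⟩
  have h2 : ({u, v} : Finset V).erase v = {u} := by
    ext x; simp only [Finset.mem_erase, Finset.mem_insert, Finset.mem_singleton]
    constructor
    · tauto
    · rintro rfl; exact ⟨h, Or.inl rfl⟩
  have h3 : ∀ x, @Finset.erase V (fun a b => Classical.propDecidable (a = b)) {u, v} x =
      ({u, v} : Finset V).erase x := fun x => by
    congr
    exact Subsingleton.elim _ _
  simp only [h3]
  rw [Finset.sum_pair h, h1, h2, add_comm]
  rfl

theorem pointChain_add_mem (hM : ∀ u, M u u = 0) (hs : ∀ u v, M u v = M v u) (hI : (0 : ℝ) ∈ I)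
    {u v : V} (h : u ≠ v) (huv : M u v ∈ I) :
    pointChain u + pointChain v ∈ simplicialBoundaries (ZMod 2) 0 (vrSkeleton M I) := by
  classical
  refine ⟨Finsupp.single {u, v} 1, Finsupp.single_mem_supported _ _ ⟨?_, ?_⟩,
    simplicialBoundary_pair h⟩
  · rw [mem_vrSkeleton, Finset.card_pair h]
    simp [hM, hI, huv, hs v u]
  · rw [Finset.card_pair h]

theorem simplicialBoundaries_le {W : Submodule (ZMod 2) (Finset V →₀ ZMod 2)}
    (hW : ∀ u v, u ≠ v → M u v ∈ I → pointChain u + pointChain v ∈ W) :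
    simplicialBoundaries (ZMod 2) 0 (vrSkeleton M I) ≤ W := by
  classical
  rw [simplicialBoundaries, simplicialChains, Finsupp.supported_eq_span_single, Submodule.map_span,
    Submodule.span_le]
  rintro _ ⟨_, ⟨s, hs, rfl⟩, rfl⟩
  obtain ⟨u, v, huv, rfl⟩ := Finset.card_eq_two.1 hs.2
  rw [simplicialBoundary_pair huv]
  exact hW u v huv (hs.1.1.2 u (by simp) v (by simp))

/-! ### Betti numbers as ranks of the boundary operator -/

variable [Fintype V]

/-- Rank-nullity for the boundary operator on edges. -/
theorem edgeCount_add : edgeCount M I = boundaryRank M I + cycleRank M I := by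
  rw [edgeCount, boundaryRank, cycleRank, simplicialCycles, if_neg one_ne_zero,
    simplicialBoundaries, Submodule.finrank_map_add_finrank_inf_ker]

theorem boundaryRank_mono (h : I ⊆ J) : boundaryRank M I ≤ boundaryRank M J :=
  Submodule.finrank_mono (Submodule.map_mono (simplicialChains_mono _ h))

theorem cycleRank_mono (h : I ⊆ J) : cycleRank M I ≤ cycleRank M J := by
  refine Submodule.finrank_mono ?_
  rw [simplicialCycles, simplicialCycles, if_neg one_ne_zero, if_neg one_ne_zero]
  exact inf_le_inf_right _ (simplicialChains_mono _ h)

/-- A 1-skeleton has no 2-simplices, so there is nothing to divide by and no cycle ever dies. -/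
theorem vrBetti_one : vrBetti 1 M I J = cycleRank M I := by
  have h : simplicialBoundaries (ZMod 2) 1 (vrSkeleton M J) = ⊥ := by
    have : {s | s ∈ (vrSkeleton M J).faces ∧ s.card = 1 + 1 + 1} = ∅ := by
      ext s
      simp only [mem_vrSkeleton, Set.mem_ofPred_eq, Set.mem_empty_iff_false, iff_false]
      rintro ⟨⟨_, h⟩, h'⟩
      omega
    rw [simplicialBoundaries, simplicialChains, this, Finsupp.supported_empty, Submodule.map_bot]
  have h2 := Submodule.finrank_map_add_finrank_inf_ker
    (simplicialCycles (ZMod 2) 1 (vrSkeleton M I))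
    (simplicialBoundaries (ZMod 2) 1 (vrSkeleton M J)).mkQ
  rw [Submodule.ker_mkQ, h, inf_bot_eq, finrank_bot, add_zero] at h2
  rw [cycleRank, ← h2, vrBetti, persistentBetti]
  change (Module.finrank (ZMod 2) (Submodule.map
    (simplicialBoundaries (ZMod 2) 1 (vrSkeleton M J)).mkQ
    (simplicialCycles (ZMod 2) 1 (vrSkeleton M I))) : ℤ) = _
  rw [h]

theorem finrank_supported {α : Type} [Fintype α] (S : Set α) :
    Module.finrank (ZMod 2) (Finsupp.supported (ZMod 2) (ZMod 2) S) = S.ncard := by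
  classical
  rw [(Finsupp.supportedEquivFinsupp S).finrank_eq, Module.finrank_finsupp_self,
    Set.ncard_eq_toFinset_card', Set.toFinset_card]

theorem ncard_singletons : {s : Finset V | s.card = 1}.ncard = Fintype.card V := by
  classical
  have : {s : Finset V | s.card = 1} = ((Finset.univ : Finset V).image fun v => {v} : Finset (Finset V)) := by
    ext s
    simp [Finset.card_eq_one, eq_comm]
  rw [this, Set.ncard_coe_finset, Finset.card_image_of_injective _ Finset.singleton_injective,
    Finset.card_univ]

/-- As soon as `0 ∈ I` all points are present, so the image is the whole space of points modulo the
boundaries of the larger complex. -/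
theorem vrBetti_zero (hM : ∀ u, M u u = 0) (hI : (0 : ℝ) ∈ I) :
    vrBetti 0 M I J = Fintype.card V - boundaryRank M J := by
  have h1 : simplicialCycles (ZMod 2) 0 (vrSkeleton M I) =
      Finsupp.supported (ZMod 2) (ZMod 2) {s : Finset V | s.card = 1} := by
    rw [simplicialCycles, if_pos rfl, simplicialChains]
    congr 1
    ext s
    simp only [mem_vrSkeleton, Set.mem_ofPred_eq, zero_add, and_iff_right_iff_imp]
    intro hs
    obtain ⟨v, rfl⟩ := Finset.card_eq_one.1 hs
    simp [hM, hI]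
  have h2 := Submodule.finrank_map_add_finrank_inf_ker
    (simplicialCycles (ZMod 2) 0 (vrSkeleton M I))
    (simplicialBoundaries (ZMod 2) 0 (vrSkeleton M J)).mkQ
  rw [Submodule.ker_mkQ, h1, inf_eq_right.2 boundaries_le_singletons, finrank_supported,
    ncard_singletons] at h2
  change (Module.finrank (ZMod 2) (Submodule.map
    (simplicialBoundaries (ZMod 2) 0 (vrSkeleton M J)).mkQ
    (simplicialCycles (ZMod 2) 0 (vrSkeleton M I))) : ℤ) = _
  rw [h1, ← h2, boundaryRank]
  push_cast
  ring

/-- The number of ordered pairs of distinct points with value in `I`. -/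
noncomputable def dartCount (M : V → V → ℝ) (I : Set ℝ) : ℕ :=
  open Classical in (Finset.univ.filter fun p : V × V => p.1 ≠ p.2 ∧ M p.1 p.2 ∈ I).card

theorem two_mul_edgeCount (hM : ∀ u, M u u = 0) (hs : ∀ u v, M u v = M v u) (hI : (0 : ℝ) ∈ I) :
    2 * edgeCount M I = dartCount M I := by
  classical
  rw [edgeCount, simplicialChains, finrank_supported, Set.ncard_eq_toFinset_card', dartCount]
  have hmaps : ∀ p ∈ Finset.univ.filter fun p : V × V => p.1 ≠ p.2 ∧ M p.1 p.2 ∈ I,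
      ({p.1, p.2} : Finset V) ∈ {s | s ∈ (vrSkeleton M I).faces ∧ s.card = 1 + 1}.toFinset := by
    rintro ⟨u, v⟩ h
    simp only [Finset.mem_filter, Finset.mem_univ, true_and] at h
    simp only [Set.mem_toFinset, Set.mem_ofPred_eq, mem_vrSkeleton, Finset.card_pair h.1]
    simp [hM, hI, h.2, hs v u]
  -- Each edge is the image of exactly two ordered pairs.
  rw [Finset.card_eq_sum_card_fiberwise hmaps, Finset.sum_const_nat (m := 2), mul_comm]
  intro s hs'
  simp only [Set.mem_toFinset, Set.mem_ofPred_eq, mem_vrSkeleton] at hs'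
  obtain ⟨a, b, hab, rfl⟩ := Finset.card_eq_two.1 hs'.2
  have hmem : M a b ∈ I := hs'.1.1.2 a (by simp) b (by simp)
  have : ((Finset.univ.filter fun p : V × V => p.1 ≠ p.2 ∧ M p.1 p.2 ∈ I).filter
      fun p => ({p.1, p.2} : Finset V) = {a, b}) = {(a, b), (b, a)} := by
    ext ⟨u, v⟩
    simp only [Finset.mem_filter, Finset.mem_univ, true_and, Finset.mem_insert,
      Finset.mem_singleton, Prod.mk.injEq]
    constructor
    · rintro ⟨⟨huv, -⟩, h⟩
      have hu : u ∈ ({a, b} : Finset V) := h ▸ by simp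
      have hv : v ∈ ({a, b} : Finset V) := h ▸ by simp
      simp only [Finset.mem_insert, Finset.mem_singleton] at hu hv
      rcases hu with rfl | rfl <;> rcases hv with rfl | rfl <;> simp_all
    · rintro (⟨rfl, rfl⟩ | ⟨rfl, rfl⟩)
      · exact ⟨⟨hab, hmem⟩, rfl⟩
      · exact ⟨⟨hab.symm, hs v u ▸ hmem⟩, Finset.pair_comm _ _⟩
  rw [this, Finset.card_pair]
  simp [hab]

theorem dartCount_Iic (d : ℝ) :
    dartCount M (Set.Iic d) = dartCount M (Set.Iio d) + dartCount M {d} := by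
  classical
  rw [dartCount, dartCount, dartCount, ← Finset.card_union_of_disjoint]
  · congr 1
    ext p
    simp only [Finset.mem_filter, Finset.mem_univ, true_and, Finset.mem_union, Set.mem_Iic,
      Set.mem_Iio, Set.mem_singleton_iff, le_iff_lt_or_eq]
    tauto
  · rw [Finset.disjoint_left]
    intro p h1 h2
    simp only [Finset.mem_filter, Set.mem_Iio, Set.mem_singleton_iff] at h1 h2
    exact h1.2.2.ne h2.2.2

/-! The multiplicities of the points of the diagrams. -/

variable {r : ℝ}

theorem mem_criticalScales {t : ℝ} : t ∈ criticalScales M r ↔ (∃ u v, M u v = t) ∧ t ≤ r := by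
  simp [criticalScales]

theorem count_persistenceDiagram_coe (n : ℕ) (b d : ℝ) :
    (persistenceDiagram n M r).count (b, (d : WithTop ℝ)) =
      if b ∈ criticalScales M r ∧ d ∈ criticalScales M r ∧ b < d then diagramMultiplicity n M b d
      else 0 := by
  classical
  have h2 : (∑ b' ∈ criticalScales M r, Multiset.replicate (essentialMultiplicity n M r b')
      (b', (⊤ : WithTop ℝ))).count (b, (d : WithTop ℝ)) = 0 := by
    rw [Multiset.count_sum']
    exact Finset.sum_eq_zero fun b' _ => by simp [Multiset.count_replicate]
  rw [persistenceDiagram, Multiset.count_add, h2, add_zero, Multiset.count_sum']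
  simp only [Multiset.count_sum', Multiset.count_replicate, Prod.mk.injEq, WithTop.coe_inj]
  by_cases hb : b ∈ criticalScales M r
  · rw [Finset.sum_eq_single_of_mem b hb fun b' _ hb' =>
      Finset.sum_eq_zero fun d' _ => by simp [hb']]
    simp [hb, Finset.sum_ite_eq', Finset.mem_filter]
  · rw [if_neg (by tauto)]
    refine Finset.sum_eq_zero fun b' hb' => Finset.sum_eq_zero fun d' _ => if_neg ?_
    rintro ⟨rfl, -⟩
    exact hb hb'

theorem count_persistenceDiagram_top (n : ℕ) (b : ℝ) :
    (persistenceDiagram n M r).count (b, ⊤) =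
      if b ∈ criticalScales M r then essentialMultiplicity n M r b else 0 := by
  classical
  rw [persistenceDiagram, Multiset.count_add, Multiset.count_sum', Multiset.count_sum']
  rw [Finset.sum_eq_zero fun b' _ => by
    rw [Multiset.count_sum']
    exact Finset.sum_eq_zero fun d' _ => by simp [Multiset.count_replicate]]
  simp [Multiset.count_replicate, Finset.sum_ite_eq']

theorem mem_persistenceDiagram {n : ℕ} {p : ℝ × WithTop ℝ} (h : p ∈ persistenceDiagram n M r) :
    p.2 = ⊤ ∨ ∃ d : ℝ, d ≤ r ∧ p.2 = d := by
  obtain ⟨b, d⟩ := p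
  induction d with
  | top => exact Or.inl rfl
  | coe d =>
    refine Or.inr ⟨d, ?_, rfl⟩
    rw [← Multiset.count_pos, count_persistenceDiagram_coe] at h
    split_ifs at h with hc
    · exact (mem_criticalScales.1 hc.2.1).2
    · exact absurd h (lt_irrefl 0)

/-- All components are born at `0`, so the deaths at `d` are the increment of the boundary rank
there. -/
theorem diagramMultiplicity_zero_zero (hM : ∀ u, M u u = 0) {d : ℝ} :
    (diagramMultiplicity 0 M 0 d : ℤ) =
      boundaryRank M (Set.Iic d) - boundaryRank M (Set.Iio d) := by
  have hle := boundaryRank_mono (M := M) (Set.Iio_subset_Iic_self (a := d))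
  rw [diagramMultiplicity, vrBetti_zero hM Set.self_mem_Iic, vrBetti_zero hM Set.self_mem_Iic,
    vrBetti_zero_eq_zero hM Set.self_notMem_Iio, vrBetti_zero_eq_zero hM Set.self_notMem_Iio]
  omega

theorem diagramMultiplicity_zero_pos (hM : ∀ u, M u u = 0) {b d : ℝ} (hb : 0 < b) :
    diagramMultiplicity 0 M b d = 0 := by
  rw [diagramMultiplicity, vrBetti_zero hM (Set.mem_Iic.2 hb.le),
    vrBetti_zero hM (Set.mem_Iic.2 hb.le), vrBetti_zero hM (Set.mem_Iio.2 hb),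
    vrBetti_zero hM (Set.mem_Iio.2 hb)]
  omega

theorem boundaryRank_le : boundaryRank M I ≤ Fintype.card V := by
  rw [← ncard_singletons (V := V), ← finrank_supported]
  exact Submodule.finrank_mono boundaries_le_singletons

theorem essentialMultiplicity_zero_zero (hM : ∀ u, M u u = 0) :
    (essentialMultiplicity 0 M r 0 : ℤ) = Fintype.card V - boundaryRank M (Set.Iic r) := by
  have hle := boundaryRank_le (M := M) (I := Set.Iic r)
  rw [essentialMultiplicity, vrBetti_zero hM Set.self_mem_Iic,
    vrBetti_zero_eq_zero hM Set.self_notMem_Iio]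
  omega

theorem essentialMultiplicity_zero_pos (hM : ∀ u, M u u = 0) {b : ℝ} (hb : 0 < b) :
    essentialMultiplicity 0 M r b = 0 := by
  rw [essentialMultiplicity, vrBetti_zero hM (Set.mem_Iic.2 hb.le),
    vrBetti_zero hM (Set.mem_Iio.2 hb)]
  omega

theorem essentialMultiplicity_one {b : ℝ} :
    (essentialMultiplicity 1 M r b : ℤ) = cycleRank M (Set.Iic b) - cycleRank M (Set.Iio b) := by
  have hle := cycleRank_mono (M := M) (Set.Iio_subset_Iic_self (a := b))
  rw [essentialMultiplicity, vrBetti_one, vrBetti_one]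
  omega

/-- The two diagrams together determine the number of edges of every value. -/
theorem two_mul_count_persistenceDiagram (hM : ∀ u, M u u = 0) (hs : ∀ u v, M u v = M v u)
    {d : ℝ} (hd : 0 < d) (hdr : d ≤ r) :
    2 * ((persistenceDiagram 0 M r).count (0, (d : WithTop ℝ)) +
      (persistenceDiagram 1 M r).count (d, ⊤)) = dartCount M {d} := by
  classical
  rw [count_persistenceDiagram_coe, count_persistenceDiagram_top]
  by_cases hc : d ∈ criticalScales M r
  · obtain ⟨⟨u, v, huv⟩, -⟩ := mem_criticalScales.1 hc
    have h0 : (0 : ℝ) ∈ criticalScales M r :=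
      mem_criticalScales.2 ⟨⟨u, u, hM u⟩, hd.le.trans hdr⟩
    rw [if_pos ⟨h0, hc, hd⟩, if_pos hc]
    -- Deaths at `d` are the increment of the rank, births of cycles the increment of the nullity;
    -- by rank-nullity they add up to the number of edges of value `d`.
    have h1 := diagramMultiplicity_zero_zero hM (d := d)
    have h2 := essentialMultiplicity_one (M := M) (r := r) (b := d)
    have h3 := edgeCount_add (M := M) (I := Set.Iic d)
    have h4 := edgeCount_add (M := M) (I := Set.Iio d)
    have h5 := two_mul_edgeCount hM hs (Set.mem_Iic.2 hd.le)
    have h6 := two_mul_edgeCount hM hs (Set.mem_Iio.2 hd)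
    have h7 := dartCount_Iic (M := M) d
    omega
  · rw [if_neg (by tauto), if_neg hc, dartCount, eq_comm, add_zero, mul_zero, Finset.card_eq_zero]
    refine Finset.filter_eq_empty_iff.2 ?_
    rintro p - ⟨-, hp⟩
    exact hc (mem_criticalScales.2 ⟨⟨p.1, p.2, hp⟩, hdr⟩)

/-- Increments of the boundary rank over the critical scales telescope. -/
theorem sum_boundaryRank (hM : ∀ u, M u u = 0) (hpos : ∀ u v, u ≠ v → 0 < M u v) (hr : 0 ≤ r) :
    ∑ d ∈ (criticalScales M r).filter (fun d => 0 < d),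
      ((boundaryRank M (Set.Iic d) : ℤ) - boundaryRank M (Set.Iio d)) =
        boundaryRank M (Set.Iic r) := by
  have hnonneg : ∀ u v, 0 ≤ M u v := fun u v => by
    by_cases h : u = v
    · rw [h, hM]
    · exact (hpos u v h).le
  -- Induction over initial segments `S` of the positive critical scales. When a new maximum `a` is
  -- added, the values in `{0} ∪ S` are exactly those below `a`, and those in `{0} ∪ S ∪ {a}`
  -- exactly those up to `a`.
  have key : ∀ S : Finset ℝ, S ⊆ (criticalScales M r).filter (fun d => 0 < d) →
      (∀ d ∈ S, ∀ d' ∈ (criticalScales M r).filter (fun d => 0 < d), d' ≤ d → d' ∈ S) →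
      ∑ d ∈ S, ((boundaryRank M (Set.Iic d) : ℤ) - boundaryRank M (Set.Iio d)) =
        boundaryRank M (insert 0 (S : Set ℝ)) := by
    intro S
    induction S using Finset.induction_on_max with
    | empty =>
      intro _ _
      rw [Finset.sum_empty, boundaryRank_congr (J := Set.Iic 0), boundaryRank_Iic_zero hpos,
        Nat.cast_zero]
      intro u v
      simpa using (le_antisymm_iff.trans (and_iff_left (hnonneg u v)))
    | insert a S hlt ih =>
      intro hsub hlow
      have haS : a ∉ S := fun h => lt_irrefl a (hlt a h)
      have ha := hsub (Finset.mem_insert_self a S)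
      rw [Finset.mem_filter, mem_criticalScales] at ha
      have hcrit : ∀ u v, M u v ≤ a → M u v = 0 ∨ M u v ∈ insert a S := fun u v h => by
        rcases (hnonneg u v).eq_or_lt with h0 | h0
        · exact Or.inl h0.symm
        · exact Or.inr (hlow a (Finset.mem_insert_self a S) _ (Finset.mem_filter.2
            ⟨mem_criticalScales.2 ⟨⟨u, v, rfl⟩, h.trans ha.1.2⟩, h0⟩) h)
      rw [Finset.sum_insert haS, ih ((Finset.subset_insert a S).trans hsub)]
      · rw [boundaryRank_congr (I := insert 0 (S : Set ℝ)) (J := Set.Iio a),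
          boundaryRank_congr (I := insert 0 ((insert a S : Finset ℝ) : Set ℝ)) (J := Set.Iic a)]
        · ring
        · intro u v
          simp only [Set.mem_insert_iff, Finset.mem_coe, Set.mem_Iic]
          constructor
          · rintro (h | h)
            · rw [h]; exact ha.2.le
            · rcases Finset.mem_insert.1 h with h | h
              · exact h.le
              · exact (hlt _ h).le
          · exact hcrit u v
        · intro u v
          simp only [Set.mem_insert_iff, Finset.mem_coe, Set.mem_Iio]
          constructor
          · rintro (h | h)
            · rw [h]; exact ha.2
            · exact hlt _ h
          · intro h
            rcases hcrit u v h.le with h' | h'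
            · exact Or.inl h'
            · exact Or.inr ((Finset.mem_insert.1 h').resolve_left h.ne)
      · intro d hd d' hd' hle
        rcases Finset.mem_insert.1 (hlow d (Finset.mem_insert_of_mem hd) d' hd' hle) with h | h
        · exact absurd (hlt d hd) (not_lt.2 (h ▸ hle))
        · exact h
  rw [key _ subset_rfl (fun _ _ d' hd' _ => hd'), boundaryRank_congr]
  intro u v
  simp only [Set.mem_insert_iff, Finset.mem_coe, Finset.mem_filter, mem_criticalScales,
    Set.mem_Iic]
  constructor
  · rintro (h | h)
    · rw [h]; exact hr
    · exact h.1.2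
  · intro h
    rcases (hnonneg u v).eq_or_lt with h0 | h0
    · exact Or.inl h0.symm
    · exact Or.inr ⟨⟨⟨u, v, rfl⟩, h⟩, h0⟩

/-- Every point contributes one class, which either dies or is essential: the deaths telescope to
the boundary rank at scale `r`, and the essential classes make up the rest. Positivity off the
diagonal excludes classes that die at `0` and would leave no trace. Isolated nodes are thereby
counted too. -/
theorem card_persistenceDiagram_zero (hM : ∀ u, M u u = 0) (hpos : ∀ u v, u ≠ v → 0 < M u v)
    (hr : 0 ≤ r) : (persistenceDiagram 0 M r).card = Fintype.card V := by
  have hnonneg : ∀ t ∈ criticalScales M r, 0 ≤ t := by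
    intro t ht
    obtain ⟨⟨u, v, rfl⟩, -⟩ := mem_criticalScales.1 ht
    by_cases h : u = v
    · rw [h, hM]
    · exact (hpos u v h).le
  rw [persistenceDiagram, Multiset.card_add, Multiset.card_sum, Multiset.card_sum]
  simp only [Multiset.card_sum, Multiset.card_replicate]
  rcases isEmpty_or_nonempty V with hV | ⟨⟨v⟩⟩
  · have : criticalScales M r = ∅ := Finset.eq_empty_of_forall_notMem fun t ht =>
      let ⟨⟨u, _⟩, _⟩ := mem_criticalScales.1 ht
      hV.elim u
    simp [this]
  · have h0 : (0 : ℝ) ∈ criticalScales M r := mem_criticalScales.2 ⟨⟨v, v, hM v⟩, hr⟩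
    rw [Finset.sum_eq_single_of_mem 0 h0 fun b hb hb0 => Finset.sum_eq_zero fun d _ =>
        diagramMultiplicity_zero_pos hM ((hnonneg b hb).lt_of_ne' hb0),
      Finset.sum_eq_single_of_mem 0 h0 fun b hb hb0 =>
        essentialMultiplicity_zero_pos hM ((hnonneg b hb).lt_of_ne' hb0)]
    zify
    simp only [diagramMultiplicity_zero_zero hM]
    rw [sum_boundaryRank hM hpos hr, essentialMultiplicity_zero_zero hM]
    ring

/-! Bounds for boundary ranks. -/

/-- Modulo 2 the boundary of an edge is `(u + root u) + (v + root v)` when the roots agree, so the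
chains `v + root v` with `root v ≠ v` span all boundaries. -/
theorem boundaryRank_le_of_roots [DecidableEq V] (root : V → V)
    (h : ∀ u v, u ≠ v → M u v ∈ I → root u = root v) :
    boundaryRank M I ≤ (Finset.univ.filter fun v => root v ≠ v).card := by
  classical
  let B : Finset (Finset V →₀ ZMod 2) := (Finset.univ.filter fun v => root v ≠ v).image fun v =>
    pointChain v + pointChain (root v)
  let W := Submodule.span (ZMod 2) (B : Set (Finset V →₀ ZMod 2))
  have hv : ∀ v, pointChain v + pointChain (root v) ∈ W := by
    intro v
    by_cases hr : root v = v
    · rw [hr, pointChain_add_self]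
      exact W.zero_mem
    · exact Submodule.subset_span (Finset.mem_coe.2 (Finset.mem_image_of_mem _ (by simpa using hr)))
  refine (Submodule.finrank_mono (t := W) (simplicialBoundaries_le fun u v huv hm => ?_)).trans
    ((finrank_span_finset_le_card _).trans Finset.card_image_le)
  have := W.add_mem (hv u) (hv v)
  rw [h u v huv hm] at this
  have h2 := pointChain_add_self (root v)
  convert this using 1
  rw [add_add_add_comm, h2, add_zero]

/-- Following a path from `o`, every point is congruent to `o` modulo boundaries, so the boundaries
have codimension at most one in the space of points. -/
theorem le_boundaryRank_of_connected (hM : ∀ u, M u u = 0) (hs : ∀ u v, M u v = M v u)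
    (hI : (0 : ℝ) ∈ I) (o : V) (h : ∀ v, Relation.ReflTransGen (fun u v => u ≠ v ∧ M u v ∈ I) o v) :
    Fintype.card V ≤ boundaryRank M I + 1 := by
  classical
  let W := simplicialBoundaries (ZMod 2) 0 (vrSkeleton M I) ⊔ Submodule.span (ZMod 2) {pointChain o}
  have hmem : ∀ v, pointChain v ∈ W := by
    intro v
    induction h v with
    | refl => exact Submodule.mem_sup_right (Submodule.mem_span_singleton_self _)
    | tail _ huv ih =>
      have := W.sub_mem (Submodule.mem_sup_left (pointChain_add_mem hM hs hI huv.1 huv.2)) ih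
      rwa [add_sub_cancel_left] at this
  have hle : Finsupp.supported (ZMod 2) (ZMod 2) {s : Finset V | s.card = 1} ≤ W := by
    rw [Finsupp.supported_eq_span_single, Submodule.span_le]
    rintro _ ⟨s, hs, rfl⟩
    obtain ⟨v, rfl⟩ := Finset.card_eq_one.1 hs
    exact hmem v
  rw [← ncard_singletons (V := V), ← finrank_supported]
  refine (Submodule.finrank_mono hle).trans
    ((Submodule.finrank_add_le_finrank_add_finrank _ _).trans ?_)
  exact Nat.add_le_add_left ((finrank_span_le_card _).trans (by simp)) _

theorem count_essential (hM : ∀ u, M u u = 0) (hr : 0 ≤ r) (o : V) :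
    ((persistenceDiagram 0 M r).count (0, ⊤) : ℤ) =
      Fintype.card V - boundaryRank M (Set.Iic r) := by
  rw [count_persistenceDiagram_top, if_pos (mem_criticalScales.2 ⟨⟨o, o, hM o⟩, hr⟩),
    essentialMultiplicity_zero_zero hM]

end Persistence

/-! ### Separating networks on line graphs -/

theorem eq_of_apply_zero {a b : Fin 1 → ℝ} (h : a 0 = b 0) : a = b :=
  funext fun i => by rw [Subsingleton.elim i 0]; exact h

/-- With `η = 0` the map `g` is the identity, and two real numbers are determined up to order by
their sum and absolute difference. Scalar colours are essential: entrywise, the order could be lost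
independently in each coordinate. -/
theorem phiMap_injective (σ : ℝ → ℝ) (m : MLP 1 1) : Function.Injective (phiMap σ m 0) := by
  intro p q
  induction p using Sym2.ind with | _ x y
  induction q using Sym2.ind with | _ x' y'
  intro h
  have h1 := congrFun h (Fin.castAdd 1 0)
  have h2 := congrFun h (Fin.natAdd 1 0)
  simp only [phiMap, Sym2.lift_mk, Fin.append_left, Fin.append_right, zero_smul, add_zero,
    Pi.add_apply] at h1 h2
  rw [Sym2.eq_iff]
  rcases abs_eq_abs.1 h2 with h3 | h3
  · exact Or.inl ⟨eq_of_apply_zero (by linarith), eq_of_apply_zero (by linarith)⟩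
  · exact Or.inr ⟨eq_of_apply_zero (by linarith), eq_of_apply_zero (by linarith)⟩

/-- An affinely rescaled unit through `(0, 0)` and `(1, 1)`. -/
theorem IsAnalyticSigmoidal.exists_unit_interpolating {σ : ℝ → ℝ} (hσ : IsAnalyticSigmoidal σ) :
    ∃ β w s b : ℝ, β * σ (w * 0 + s) + b = 0 ∧ β * σ (w * 1 + s) + b = 1 := by
  obtain ⟨x, y, hxy⟩ := hσ.exists_ne
  have h : σ y - σ x ≠ 0 := sub_ne_zero.2 hxy.symm
  refine ⟨1 / (σ y - σ x), y - x, x, -σ x / (σ y - σ x), ?_, ?_⟩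
  · rw [mul_zero, zero_add]; field_simp; ring
  · rw [mul_one, sub_add_cancel]; field_simp; ring

theorem IsAnalyticSigmoidal.exists_radius {σ : ℝ → ℝ} (hσ : IsAnalyticSigmoidal σ)
    {β w s b z₀ y₀ : ℝ} (h : β * σ (w * z₀ + s) + b = y₀) {η : ℝ} (hη : 0 < η) :
    ∃ δ > 0, ∀ z, |z - z₀| < δ → |β * σ (w * z + s) + b - y₀| < η := by
  have hc : Continuous fun z => β * σ (w * z + s) + b := by
    have := hσ.continuous
    fun_prop
  obtain ⟨δ, hδ, H⟩ := Metric.continuousAt_iff.1 (hc.continuousAt (x := z₀)) η hη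
  refine ⟨δ, hδ, fun z hz => ?_⟩
  have := H (x := z) (by rwa [Real.dist_eq])
  rwa [h, Real.dist_eq] at this

theorem dotProduct_const (w : ℝ) (x : Fin 1 → ℝ) : (fun _ => w) ⬝ᵥ x = w * x 0 := by
  simp [dotProduct]

theorem abs_sum_map_le {α : Type*} (M : Multiset α) (f : α → ℝ) {B : ℝ}
    (hB : ∀ a ∈ M, |f a| ≤ B) : |(M.map f).sum| ≤ M.card * B := by
  induction M using Multiset.induction_on with
  | empty => simp
  | cons a M ih =>
    rw [Multiset.map_cons, Multiset.sum_cons, Multiset.card_cons]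
    have h1 := hB a (Multiset.mem_cons_self a M)
    have h2 := ih fun x hx => hB x (Multiset.mem_cons_of_mem hx)
    push_cast
    linarith [abs_add_le (f a) (M.map f).sum]

/-- A network whose values are close to `1` and determine the input. -/
theorem IsAnalyticSigmoidal.exists_gin_near_one {σ : ℝ → ℝ} (hσ : IsAnalyticSigmoidal σ)
    {I : Type} [Countable I] {V : I → Type} [∀ i, Fintype (V i)] (G : ∀ i, SimpleGraph (V i))
    {a : ℕ} (x : ∀ i, V i → (Fin a → ℝ)) {η : ℝ} (hη : 0 < η) :
    ∃ P : GIN a 1, (∀ i v, |P.eval σ (G i) (x i) v 0 - 1| < η) ∧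
      ∀ i j u v, P.eval σ (G i) (x i) u = P.eval σ (G j) (x j) v → x i u = x j v := by
  obtain ⟨g₀, h₀⟩ := hσ.exists_mlp_sumInjOn (countable_allValues x)
  obtain ⟨ε, -, hε⟩ := exists_eps_ginAggregate G (fun i v => g₀.eval σ (x i v)) 0
  -- With `β = 0` and `b = 1` the approximated unit is the constant `1`.
  obtain ⟨g₁, hg₁, h₁⟩ := hσ.exists_mlp_sumInjOn_near
    (countable_allValues fun i => ginAggregate (G i) ε fun v => g₀.eval σ (x i v)) 0 0 0 1 hη
  refine ⟨⟨1, g₀, .one ε g₁⟩, fun i v => ?_, fun i j u v h => ?_⟩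
  · have := hg₁ (ginAggregate (G i) ε (fun v => g₀.eval σ (x i v)) v)
    rwa [zero_mul, zero_add] at this
  · exact h₀.injOn (mem_allValues x i u) (mem_allValues x j v) (hε i j u v
      (h₁.injOn (mem_allValues _ i u) (mem_allValues _ j v) h)).1

/-- A network which is positive at nodes of colour `0`, negative at nodes of colour close to `1`,
and whose values determine the input. -/
theorem IsAnalyticSigmoidal.exists_gin_separating {σ : ℝ → ℝ} (hσ : IsAnalyticSigmoidal σ)
    (K : ℕ) : ∃ η > 0, ∀ {I : Type} [Countable I] {V : I → Type} [∀ i, Fintype (V i)]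
      (G : ∀ i, SimpleGraph (V i)) (x : ∀ i, V i → (Fin 1 → ℝ)), (∀ i, Fintype.card (V i) ≤ K) →
      (∀ i v, x i v = 0 ∨ |x i v 0 - 1| < η) →
      ∃ P : GIN 1 1, (∀ i v, x i v = 0 → 0 < P.eval σ (G i) (x i) v 0) ∧
        (∀ i v, |x i v 0 - 1| < η → P.eval σ (G i) (x i) v 0 < 0) ∧
        ∀ i j u v, P.eval σ (G i) (x i) u = P.eval σ (G j) (x j) v → x i u = x j v := by
  obtain ⟨β, w, s, b, hf0, hf1⟩ := hσ.exists_unit_interpolating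
  obtain ⟨r₀, hr₀, H₀⟩ := hσ.exists_radius hf0 (η := 1 / 4) (by norm_num)
  obtain ⟨r₁, hr₁, H₁⟩ := hσ.exists_radius hf1 (η := 1 / 4) (by norm_num)
  let r := min (min r₀ r₁) 1
  have hr : 0 < r := by positivity
  have hrr₀ : r ≤ r₀ := (min_le_left _ _).trans (min_le_left _ _)
  have hrr₁ : r ≤ r₁ := (min_le_left _ _).trans (min_le_right _ _)
  have hr1 : r ≤ 1 := min_le_right _ _
  -- `η` is fixed before the graphs and colours are given, because the network producing the colours
  -- close to `1` has to be tuned to it.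
  obtain ⟨η, hη, Hη⟩ := hσ.exists_radius hf1 (η := r / 4) (by positivity)
  refine ⟨η, hη, fun {I} _ {V} _ G x hK hx => ?_⟩
  obtain ⟨g₀, hg₀, h₀⟩ := hσ.exists_mlp_sumInjOn_near (countable_allValues x) β (fun _ => w) s b
    (η := r / 4) (by positivity)
  simp only [dotProduct_const] at hg₀
  let y : ∀ i, V i → (Fin 1 → ℝ) := fun i v => g₀.eval σ (x i v)
  have hy0 : ∀ i v, x i v = 0 → |y i v 0| < r / 4 := by
    intro i v h
    have := hg₀ (x i v)
    rwa [h, Pi.zero_apply, hf0, sub_zero, ← h] at this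
  have hy1 : ∀ i v, |x i v 0 - 1| < η → |y i v 0 - 1| < r / 2 := by
    intro i v h
    have h1 := abs_lt.1 (hg₀ (x i v))
    have h2 := abs_lt.1 (Hη _ h)
    rw [abs_lt]
    simp only [y]
    constructor <;> linarith
  have hyB : ∀ i v, |y i v 0| ≤ 2 := by
    intro i v
    rcases hx i v with h | h
    · linarith [hy0 i v h]
    · have := abs_lt.1 (hy1 i v h)
      rw [abs_le]
      constructor <;> linarith
  -- There are at most `K` neighbours with values at most `2`. With `1 + ε > 4 * K / r` their sum,
  -- divided by `1 + ε`, stays below `r / 2`, so the node's own value dominates.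
  obtain ⟨ε, hε0, hε⟩ := exists_eps_ginAggregate G y (4 * K / r)
  have hεpos : 0 < 1 + ε := lt_of_le_of_lt (by positivity) hε0
  have hagg : ∀ i v, |ginAggregate (G i) ε (y i) v 0 / (1 + ε) - y i v 0| < r / 2 := by
    intro i v
    have h1 : ginAggregate (G i) ε (y i) v 0 / (1 + ε) - y i v 0 =
        ((nbrs (G i) v).map fun u => y i u 0).sum / (1 + ε) := by
      rw [ginAggregate_eq, Pi.add_apply, sum_map_apply, Pi.smul_apply, smul_eq_mul]
      field_simp
      ring
    have h2 := abs_sum_map_le (nbrs (G i) v) (fun u => y i u 0) (B := 2) fun u _ => hyB i u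
    have h3 : ((nbrs (G i) v).card : ℝ) ≤ K := by
      exact_mod_cast (Finset.card_le_univ _).trans (hK i)
    rw [h1, abs_div, abs_of_pos hεpos, div_lt_iff₀ hεpos]
    rw [div_lt_iff₀ hr] at hε0
    linarith
  -- The target is `1 - 2 * f (z / (1 + ε))` for the interpolating unit `f`: it is `1` at `0` and
  -- `-1` at `1`, and the total error `2 / 4 + 1 / 4` does not change the sign.
  obtain ⟨g₁, hg₁, h₁⟩ := hσ.exists_mlp_sumInjOn_near
    (countable_allValues fun i => ginAggregate (G i) ε (y i)) (-2 * β) (fun _ => w / (1 + ε)) s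
    (1 - 2 * b) (η := 1 / 4) (by norm_num)
  simp only [dotProduct_const] at hg₁
  have hval : ∀ z : Fin 1 → ℝ, |g₁.eval σ z 0 -
      (1 - 2 * (β * σ (w * (z 0 / (1 + ε)) + s) + b))| < 1 / 4 := by
    intro z
    have := hg₁ z
    have e : w / (1 + ε) * z 0 = w * (z 0 / (1 + ε)) := by ring
    rw [e] at this
    convert this using 2
    ring
  refine ⟨⟨1, g₀, .one ε g₁⟩, fun i v h => ?_, fun i v h => ?_, fun i j u v h => ?_⟩
  · have h1 := abs_lt.1 (hagg i v)
    have h2 := abs_lt.1 (hy0 i v h)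
    have h3 := abs_lt.1 (H₀ (ginAggregate (G i) ε (y i) v 0 / (1 + ε)) (by
      rw [sub_zero, abs_lt]; constructor <;> linarith))
    have h4 := abs_lt.1 (hval (ginAggregate (G i) ε (y i) v))
    change 0 < g₁.eval σ (ginAggregate (G i) ε (y i) v) 0
    linarith
  · have h1 := abs_lt.1 (hagg i v)
    have h2 := abs_lt.1 (hy1 i v h)
    have h3 := abs_lt.1 (H₁ (ginAggregate (G i) ε (y i) v 0 / (1 + ε)) (by
      rw [abs_lt]; constructor <;> linarith))
    have h4 := abs_lt.1 (hval (ginAggregate (G i) ε (y i) v))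
    change g₁.eval σ (ginAggregate (G i) ε (y i) v) 0 < 0
    linarith
  · exact h₀.injOn (mem_allValues x i u) (mem_allValues x j v) (hε i j u v
      (h₁.injOn (mem_allValues _ i u) (mem_allValues _ j v) h)).1

/-! ### The filtration matrix -/

section Filtration

variable {σ : ℝ → ℝ} {d : ℕ} (θ : LGVRWeights d) {V : Type} [Fintype V] (G : SimpleGraph V)
  (c : V → (Fin d → ℝ))

theorem filtrationMatrix_self (u : V) : θ.filtrationMatrix σ G c u u = 0 := by
  simp [LGVRWeights.filtrationMatrix]

theorem filtrationMatrix_of_ne {u v : V} (h : u ≠ v) :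
    θ.filtrationMatrix σ G c u v = θ.edgeValue σ G c ⟨s(u, v), h⟩ := by
  simp [LGVRWeights.filtrationMatrix, h]

theorem filtrationMatrix_symm (u v : V) :
    θ.filtrationMatrix σ G c u v = θ.filtrationMatrix σ G c v u := by
  by_cases h : u = v
  · rw [h]
  · rw [filtrationMatrix_of_ne θ G c h, filtrationMatrix_of_ne θ G c (Ne.symm h)]
    congr 1
    exact Subtype.ext Sym2.eq_swap

theorem filtrationMatrix_pos {u v : V} (h : u ≠ v) : 0 < θ.filtrationMatrix σ G c u v := by
  rw [filtrationMatrix_of_ne θ G c h]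
  exact Real.sigmoid_pos _

end Filtration

open Classical in
theorem card_edgeSet_le {V : Type} [Fintype V] (G : SimpleGraph V) [Fintype G.edgeSet] :
    Fintype.card G.edgeSet ≤ Fintype.card V * Fintype.card V := by
  rw [← Fintype.card_prod]
  exact (Fintype.card_le_of_injective (Subtype.val : G.edgeSet → Sym2 V)
    Subtype.val_injective).trans (Fintype.card_le_of_surjective _ Sym2.mk_surjective)

/-- Weights such that exactly the values of edges are below `1/2`, and such that these values
determine the colours of the endpoints. -/
theorem IsAnalyticSigmoidal.exists_lgvrWeights {σ : ℝ → ℝ} (hσ : IsAnalyticSigmoidal σ)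
    {I : Type} [Countable I] {V : I → Type} [∀ i, Fintype (V i)] (G : ∀ i, SimpleGraph (V i))
    (c : ∀ i, V i → (Fin 1 → ℝ)) {n : ℕ} (hn : ∀ i, Fintype.card (V i) ≤ n) :
    ∃ θ : LGVRWeights 1,
      (∀ i u v, u ≠ v → (θ.filtrationMatrix σ (G i) (c i) u v ≤ 1 / 2 ↔ (G i).Adj u v)) ∧
      ∀ i j u v u' v', (G i).Adj u v → (G j).Adj u' v' →
        θ.filtrationMatrix σ (G i) (c i) u v = θ.filtrationMatrix σ (G j) (c j) u' v' →
        s(c i u, c i v) = s(c j u', c j v') := by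
  classical
  obtain ⟨η, hη, H⟩ := hσ.exists_gin_separating (n * n)
  -- The choice of `m` is immaterial, since it enters with coefficient `η = 0` in `phiMap`.
  let m : MLP 1 1 := MLP.twoUnits 0 0 0 0 0 0 0
  obtain ⟨P₁, hP₁, hP₁'⟩ := hσ.exists_gin_near_one (V := fun i => (G i).edgeSet)
    (fun i => (G i).lineGraph) (fun i e => phiMap σ m 0 (Sym2.map (c i) e.1)) hη
  let x : ∀ i, (⊤ : SimpleGraph (V i)).edgeSet → (Fin 1 → ℝ) := fun i f =>
    if h : f.1 ∈ (G i).edgeSet then P₁.eval σ (G i).lineGraph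
      (fun e => phiMap σ m 0 (Sym2.map (c i) e.1)) ⟨f.1, h⟩ else 0
  obtain ⟨P₂, hP0, hP1, hP₂⟩ := H (V := fun i => (⊤ : SimpleGraph (V i)).edgeSet)
    (fun i => (⊤ : SimpleGraph (V i)).lineGraph) x
    (fun i => (card_edgeSet_le _).trans (Nat.mul_le_mul (hn i) (hn i))) (fun i f => by
      by_cases h : f.1 ∈ (G i).edgeSet
      · right
        simp only [x, dif_pos h]
        exact hP₁ i ⟨f.1, h⟩
      · left
        simp only [x, dif_neg h])
  have hval : ∀ i u v (h : u ≠ v),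
      (⟨m, 0, 1, P₁, P₂⟩ : LGVRWeights 1).filtrationMatrix σ (G i) (c i) u v =
        Real.sigmoid (P₂.eval σ (⊤ : SimpleGraph (V i)).lineGraph (x i) ⟨s(u, v), h⟩ 0) := by
    intro i u v h
    rw [filtrationMatrix_of_ne _ _ _ h]
    simp only [LGVRWeights.edgeValue, LGVRWeights.lineColor, x]
  refine ⟨⟨m, 0, 1, P₁, P₂⟩, fun i u v huv => ?_, fun i j u v u' v' h h' heq => ?_⟩
  · rw [hval i u v huv]
    by_cases h : (G i).Adj u v
    · refine iff_of_true ?_ h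
      have := hP1 i ⟨s(u, v), huv⟩ (by
        simp only [x]
        rw [dif_pos ((G i).mem_edgeSet.2 h)]
        exact hP₁ i _)
      -- The logistic function takes the value `1/2` at `0`, so the sign of the output of `P₂`
      -- decides on which side of the cut-off the pair lies.
      rw [one_div, ← Real.sigmoid_zero]
      exact Real.sigmoid_strictMono.monotone this.le
    · refine iff_of_false (not_le.2 ?_) h
      have := hP0 i ⟨s(u, v), huv⟩ (by
        simp only [x]
        rw [dif_neg (fun h' => h ((G i).mem_edgeSet.1 h'))])
      rw [one_div, ← Real.sigmoid_zero]
      exact Real.sigmoid_strictMono this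
  · rw [hval i u v h.ne, hval j u' v' h'.ne] at heq
    have h1 := hP₂ i j _ _ (eq_of_apply_zero (Real.sigmoid_strictMono.injective heq))
    simp only [x] at h1
    rw [dif_pos ((G i).mem_edgeSet.2 h), dif_pos ((G j).mem_edgeSet.2 h')] at h1
    have h2 := phiMap_injective σ m (hP₁' i j _ _ h1)
    simpa using h2

/-! ### Encoding of the diagrams -/

theorem SumInjOn.comp {α β E : Type*} [AddCommMonoid E] {f : β → E} {g : α → β} {S : Set α}
    (hf : SumInjOn f (g '' S)) (hg : Set.InjOn g S) : SumInjOn (fun x => f (g x)) S := by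
  intro M M' hM hM' hs
  have h := hf (M.map g) (M'.map g)
    (fun y hy => by obtain ⟨x, hx, rfl⟩ := Multiset.mem_map.1 hy; exact ⟨x, hM x hx, rfl⟩)
    (fun y hy => by obtain ⟨x, hx, rfl⟩ := Multiset.mem_map.1 hy; exact ⟨x, hM' x hx, rfl⟩)
    (by rwa [Multiset.map_map, Multiset.map_map])
  simpa using Multiset.map_eq_map_of_determines (g := id) (g' := id)
    (fun a ha b hb hab => hg (hM a ha) (hM' b hb) hab) h

/-- Finite deaths are at most `1/2`, so entering `⊤` as `1` causes no collision. -/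
theorem diagramPoint_injOn :
    Set.InjOn diagramPoint {p | p.2 = ⊤ ∨ ∃ d : ℝ, d ≤ 1 / 2 ∧ p.2 = d} := by
  rintro ⟨b, d⟩ hp ⟨b', d'⟩ hq h
  have h1 : b = b' := congrFun h 0
  have h2 : d.untopD 1 = d'.untopD 1 := congrFun h 1
  subst h1
  rcases hp with rfl | ⟨e, he, rfl⟩ <;> rcases hq with rfl | ⟨e', he', rfl⟩
  · rfl
  · simp only [WithTop.untopD_top, WithTop.untopD_coe] at h2
    linarith
  · simp only [WithTop.untopD_top, WithTop.untopD_coe] at h2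
    linarith
  · simp only [WithTop.untopD_coe] at h2
    rw [h2]

/-- Countably many finite diagrams contain countably many points, so sums of a generic perceptron
recover each diagram; the outer perceptron only has to be injective on countably many vectors. -/
theorem IsAnalyticSigmoidal.exists_setEncoder {σ : ℝ → ℝ} (hσ : IsAnalyticSigmoidal σ)
    {I : Type} [Countable I] (D : I → Multiset (ℝ × WithTop ℝ) × Multiset (ℝ × WithTop ℝ))
    (hD : ∀ i, ∀ p, p ∈ (D i).1 ∨ p ∈ (D i).2 → p.2 = ⊤ ∨ ∃ d : ℝ, d ≤ 1 / 2 ∧ p.2 = d) :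
    ∃ S : SetEncoder 1, ∀ i j, S.eval σ (D i) = S.eval σ (D j) → D i = D j := by
  let P : Set (ℝ × WithTop ℝ) := ⋃ i, {p | p ∈ (D i).1 ∨ p ∈ (D i).2}
  have hP : P.Countable := by
    classical
    refine Set.countable_iUnion fun i => Set.Countable.mono (fun p hp => ?_)
      ((D i).1 + (D i).2).toFinset.countable_toSet
    simpa using hp
  have hinj : Set.InjOn diagramPoint P := diagramPoint_injOn.mono fun p hp => by
    obtain ⟨i, hi⟩ := Set.mem_iUnion.1 hp
    exact hD i p hi
  have hmem : ∀ i p, p ∈ (D i).1 ∨ p ∈ (D i).2 → p ∈ P := fun i p hp => Set.mem_iUnion.2 ⟨i, hp⟩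
  obtain ⟨S, hS⟩ := hσ.exists_mlp_sumInjOn (hP.image diagramPoint)
  have hS' := hS.comp hinj
  obtain ⟨m, hm⟩ := hσ.exists_mlp_sumInjOn (Set.countable_range fun i =>
    Fin.append (((D i).1.map fun p => S.eval σ (diagramPoint p)).sum)
      (((D i).2.map fun p => S.eval σ (diagramPoint p)).sum))
  refine ⟨⟨1, 1, S, S, m⟩, fun i j h => ?_⟩
  have h := hm.injOn ⟨i, rfl⟩ ⟨j, rfl⟩ h
  refine Prod.ext (hS' _ _ (fun p hp => hmem i p (.inl hp)) (fun p hp => hmem j p (.inl hp)) ?_)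
    (hS' _ _ (fun p hp => hmem i p (.inr hp)) (fun p hp => hmem j p (.inr hp)) ?_)
  · ext k
    have := congrFun h (Fin.castAdd 1 k)
    simpa only [Fin.append_left] using this
  · ext k
    have := congrFun h (Fin.natAdd 1 k)
    simpa only [Fin.append_right] using this

/-! ### Recovering node colours from the colours of edges -/

section Darts

variable {V V' E : Type} [Fintype V] [Fintype V'] {G : SimpleGraph V} {G' : SimpleGraph V'}

theorem card_nbrs_eq_of_wlColor {X : Type} {x : V → X} {x' : V' → X} {T : ℕ} {u : V} {v : V'}
    (h : wlColor G x (T + 1) u = wlColor G' x' (T + 1) v) : (nbrs G u).card = (nbrs G' v).card := by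
  simpa using congrArg Multiset.card (wlColor_succ_eq_iff.1 h).2

open Classical in
/-- The ordered pairs of adjacent nodes. -/
noncomputable def dartSet (G : SimpleGraph V) : Finset (V × V) :=
  Finset.univ.filter fun p => G.Adj p.1 p.2

theorem mem_dartSet {p : V × V} : p ∈ dartSet G ↔ G.Adj p.1 p.2 := by
  simp [dartSet]

/-- The pairs of distinct points with value in `(0, r]` are exactly the edges, so the counts at
these scales are the multiplicities of the edge values. -/
theorem map_dartSet_eq {M : V → V → ℝ} {M' : V' → V' → ℝ} {r : ℝ}
    (hM : ∀ u v, u ≠ v → (M u v ≤ r ↔ G.Adj u v)) (hM' : ∀ u v, u ≠ v → (M' u v ≤ r ↔ G'.Adj u v))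
    (hpos : ∀ u v, u ≠ v → 0 < M u v) (hpos' : ∀ u v, u ≠ v → 0 < M' u v)
    (h : ∀ d, 0 < d → d ≤ r → dartCount M {d} = dartCount M' {d}) :
    (dartSet G).val.map (fun p => M p.1 p.2) = (dartSet G').val.map (fun p => M' p.1 p.2) := by
  classical
  have key : ∀ {W : Type} [Fintype W] {H : SimpleGraph W} {A : W → W → ℝ},
      (∀ u v, u ≠ v → (A u v ≤ r ↔ H.Adj u v)) → (∀ u v, u ≠ v → 0 < A u v) → ∀ d,
      ((dartSet H).val.map fun p => A p.1 p.2).count d =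
        if 0 < d ∧ d ≤ r then dartCount A {d} else 0 := by
    intro W _ H A hA hApos d
    rw [Multiset.count_map, ← Finset.filter_val, Finset.card_val]
    split_ifs with hd
    · rw [dartCount]
      congr 1
      ext p
      simp only [Finset.mem_filter, mem_dartSet, Finset.mem_univ, true_and,
        Set.mem_singleton_iff]
      constructor
      · rintro ⟨h1, h2⟩
        exact ⟨h1.ne, h2.symm⟩
      · rintro ⟨h1, h2⟩
        exact ⟨(hA _ _ h1).1 (h2 ▸ hd.2), h2.symm⟩
    · rw [Finset.card_eq_zero]
      refine Finset.filter_eq_empty_iff.2 fun p hp hpd => hd ?_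
      rw [mem_dartSet] at hp
      rw [hpd]
      exact ⟨hApos _ _ hp.ne, (hA _ _ hp.ne).2 hp⟩
  ext d
  rw [key hM hpos, key hM' hpos']
  split_ifs with hd
  · exact h d hd.1 hd.2
  · rfl

open Classical in
-- Handshake count restricted to one colour. The summand is symmetric in the two ends, so it depends
-- only on the unordered pair of colours, which is all that edge values reveal.
theorem two_mul_sum_card_nbrs (c : V → E) (κ : E) :
    2 * ∑ u with c u = κ, (nbrs G u).card =
      ∑ p ∈ dartSet G, ((if c p.1 = κ then 1 else 0) + (if c p.2 = κ then 1 else 0)) := by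
  have h1 : ∑ p ∈ dartSet G, (if c p.1 = κ then 1 else 0) = ∑ u with c u = κ, (nbrs G u).card := by
    rw [dartSet, Finset.sum_filter, Fintype.sum_prod_type, Finset.sum_filter]
    refine Finset.sum_congr rfl fun u _ => ?_
    split_ifs with hu
    · rw [← Finset.sum_filter, Finset.sum_const, smul_eq_mul, mul_one]
      rfl
    · simp
  have h2 : ∑ p ∈ dartSet G, (if c p.2 = κ then 1 else 0) =
      ∑ p ∈ dartSet G, (if c p.1 = κ then 1 else 0) :=
    Finset.sum_equiv (Equiv.prodComm V V) (fun p => by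
      rw [mem_dartSet, mem_dartSet]
      exact G.adj_comm _ _) fun p _ => rfl
  rw [Finset.sum_add_distrib, h2, h1, two_mul]

open Classical in
/-- The nodes which are not isolated. -/
noncomputable def nonIsolated (G : SimpleGraph V) : Finset V :=
  Finset.univ.filter fun u => ∃ v, G.Adj u v

theorem card_nbrs_pos {u : V} : 0 < (nbrs G u).card ↔ ∃ v, G.Adj u v := by
  simp only [Multiset.card_pos_iff_exists_mem, mem_nbrs]

/-- If colours determine degrees, then the colours of the endpoints of all edges determine the
colours of the non-isolated nodes. -/
theorem map_nonIsolated_eq {c : V → E} {c' : V' → E}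
    (hG : ∀ u v, c u = c v → (nbrs G u).card = (nbrs G v).card)
    (hGG : ∀ u v, c u = c' v → (nbrs G u).card = (nbrs G' v).card)
    (hG' : ∀ u v, c' u = c' v → (nbrs G' u).card = (nbrs G' v).card)
    (h : (dartSet G).val.map (fun p => s(c p.1, c p.2)) =
      (dartSet G').val.map (fun p => s(c' p.1, c' p.2))) :
    (nonIsolated G).val.map c = (nonIsolated G').val.map c' := by
  classical
  ext κ
  have hsum : ∑ u with c u = κ, (nbrs G u).card = ∑ u with c' u = κ, (nbrs G' u).card := by
    refine Nat.eq_of_mul_eq_mul_left two_pos ?_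
    rw [two_mul_sum_card_nbrs, two_mul_sum_card_nbrs]
    refine congrArg Multiset.sum (Multiset.map_eq_map_of_determines (fun p _ q _ hpq => ?_) h)
    rcases Sym2.eq_iff.1 hpq with ⟨h1, h2⟩ | ⟨h1, h2⟩
    · rw [h1, h2]
    · rw [h1, h2, add_comm]
  -- All nodes of colour `κ` have the same degree `k`, so the number of edge ends of that colour is
  -- `k` times the number of its nodes; `k > 0` permits division.
  have key : ∀ {W : Type} [Fintype W] (H : SimpleGraph W) (a : W → E) (k : ℕ), 0 < k →
      (∀ u, a u = κ → (nbrs H u).card = k) →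
      k * ((nonIsolated H).val.map a).count κ = ∑ u with a u = κ, (nbrs H u).card := by
    intro W _ H a k hk ha
    rw [Multiset.count_map, ← Finset.filter_val, Finset.card_val,
      Finset.sum_const_nat (m := k) (fun u hu => ha u (Finset.mem_filter.1 hu).2), mul_comm]
    congr 2
    ext u
    simp only [nonIsolated, Finset.mem_filter, Finset.mem_univ, true_and, eq_comm (a := κ)]
    exact ⟨fun h => h.2, fun h => ⟨card_nbrs_pos.1 (ha u h ▸ hk), h⟩⟩
  have fin : ∀ k, 0 < k → (∀ u, c u = κ → (nbrs G u).card = k) →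
      (∀ u, c' u = κ → (nbrs G' u).card = k) →
      ((nonIsolated G).val.map c).count κ = ((nonIsolated G').val.map c').count κ :=
    fun k hk h1 h2 => Nat.eq_of_mul_eq_mul_left hk (by rw [key G c k hk h1, key G' c' k hk h2, hsum])
  by_cases hmem : κ ∈ (nonIsolated G).val.map c
  · obtain ⟨u, hu, rfl⟩ := Multiset.mem_map.1 hmem
    exact fin _ (card_nbrs_pos.2 (Finset.mem_filter.1 hu).2) (fun v hv => hG v u hv)
      (fun v hv => (hGG u v hv.symm).symm)
  by_cases hmem' : κ ∈ (nonIsolated G').val.map c'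
  · obtain ⟨u, hu, rfl⟩ := Multiset.mem_map.1 hmem'
    exact fin _ (card_nbrs_pos.2 (Finset.mem_filter.1 hu).2) (fun v hv => hGG v u hv)
      (fun v hv => hG' v u hv)
  · rw [Multiset.count_eq_zero_of_notMem hmem, Multiset.count_eq_zero_of_notMem hmem']

/-- The isolated nodes are equal in number, by subtraction, and all carry the same value. -/
theorem map_univ_eq_of_nonIsolated {D : Type} {f : V → D} {f' : V' → D}
    (hcard : Fintype.card V = Fintype.card V')
    (h : (nonIsolated G).val.map f = (nonIsolated G').val.map f')
    (hiso : ∀ u v, (∀ w, ¬ G.Adj u w) → (∀ w, ¬ G'.Adj v w) → f u = f' v) :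
    (Finset.univ : Finset V).val.map f = (Finset.univ : Finset V').val.map f' := by
  classical
  rw [← Multiset.filter_add_not (fun u => ∃ v, G.Adj u v) (Finset.univ : Finset V).val,
    ← Multiset.filter_add_not (fun u => ∃ v, G'.Adj u v) (Finset.univ : Finset V').val,
    Multiset.map_add, Multiset.map_add, ← Finset.filter_val, ← Finset.filter_val,
    ← Finset.filter_val, ← Finset.filter_val]
  have h1 : (nonIsolated G).card = (nonIsolated G').card := by
    simpa using congrArg Multiset.card h
  have h2 := Finset.card_filter_add_card_filter_not (s := (Finset.univ : Finset V)) (fun u => ∃ v, G.Adj u v)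
  have h3 := Finset.card_filter_add_card_filter_not (s := (Finset.univ : Finset V')) (fun u => ∃ v, G'.Adj u v)
  rw [Finset.card_univ] at h2 h3
  refine congrArg₂ (· + ·) ?_ ?_
  · convert h using 3 <;> simp [nonIsolated]
  · refine Multiset.map_eq_map_of_determines (f := fun _ => ()) (f' := fun _ => ())
      (fun a ha b hb _ => hiso a b ?_ ?_) ?_
    · simpa using ha
    · simpa using hb
    · rw [Multiset.map_const', Multiset.map_const', Finset.card_val, Finset.card_val]
      congr 1
      have e1 : (nonIsolated G).card = (Finset.univ.filter fun u => ∃ v, G.Adj u v).card := by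
        simp [nonIsolated]
      have e2 : (nonIsolated G').card = (Finset.univ.filter fun u => ∃ v, G'.Adj u v).card := by
        simp [nonIsolated]
      omega

end Darts

/-! ### Two regular graphs -/

/-- The cycle of length six. -/
def hexagon : SimpleGraph (Fin 6) where
  Adj i j := i = j + 1 ∨ j = i + 1
  symm := ⟨fun _ _ h => h.symm⟩
  loopless := ⟨by decide⟩

/-- Two disjoint triangles. -/
def twoTriangles : SimpleGraph (Fin 6) where
  Adj i j := i ≠ j ∧ i.val % 2 = j.val % 2
  symm := ⟨fun _ _ h => ⟨h.1.symm, h.2.symm⟩⟩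
  loopless := ⟨by decide⟩

theorem card_nbrs_hexagon (u : Fin 6) : (nbrs hexagon u).card = 2 := by
  classical
  have : Finset.univ.filter (fun v => hexagon.Adj u v) =
      Finset.univ.filter (fun v => u = v + 1 ∨ v = u + 1) := by
    refine Finset.filter_congr fun v _ => Iff.rfl
  have h2 : ∀ u : Fin 6, (Finset.univ.filter (fun v => u = v + 1 ∨ v = u + 1)).card = 2 := by
    decide
  rw [nbrs, Finset.card_val, ← h2 u]
  convert congrArg Finset.card this

theorem card_nbrs_twoTriangles (u : Fin 6) : (nbrs twoTriangles u).card = 2 := by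
  classical
  have : Finset.univ.filter (fun v => twoTriangles.Adj u v) =
      Finset.univ.filter (fun v => u ≠ v ∧ u.val % 2 = v.val % 2) := by
    refine Finset.filter_congr fun v _ => Iff.rfl
  have h2 : ∀ u : Fin 6,
      (Finset.univ.filter (fun v : Fin 6 => u ≠ v ∧ u.val % 2 = v.val % 2)).card = 2 := by
    decide
  rw [nbrs, Finset.card_val, ← h2 u]
  convert congrArg Finset.card this

/-- A graph on six nodes with constant features. -/
def constGraph {N : ℕ} (G : SimpleGraph (Fin 6)) (c : Fin N → ℝ) : FGraph N := ⟨6, G, fun _ => c⟩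

theorem not_wlDistinguishes_hexagon {N : ℕ} (c : Fin N → ℝ) :
    ¬ WLDistinguishes (constGraph hexagon c) (constGraph twoTriangles c) := by
  rintro ⟨t, ht⟩
  refine ht (Multiset.map_eq_map_of_determines (f := fun _ => ()) (f' := fun _ => ())
    (fun a _ b _ _ => wlColor_eq_of_regular card_nbrs_hexagon card_nbrs_twoTriangles
      (fun _ _ => rfl) t a b) rfl)

/-- The multiplicity of `(0, ⊤)` is the number of components at scale `r`, and the boundary rank is
at least 5 for the hexagon but at most 4 for the triangles. -/
theorem persistenceDiagram_hexagon_ne {M M' : Fin 6 → Fin 6 → ℝ} {r : ℝ} (hr : 0 ≤ r)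
    (hM : ∀ u v, u ≠ v → (M u v ≤ r ↔ hexagon.Adj u v))
    (hM' : ∀ u v, u ≠ v → (M' u v ≤ r ↔ twoTriangles.Adj u v))
    (h0 : ∀ u, M u u = 0) (h0' : ∀ u, M' u u = 0) (hs : ∀ u v, M u v = M v u) :
    persistenceDiagram 0 M r ≠ persistenceDiagram 0 M' r := by
  intro h
  have h1 := count_essential h0 hr 0
  have h2 := count_essential h0' hr 0
  rw [h, h2] at h1
  -- The triangles are the parity classes, with roots `0` and `1`; four nodes are not roots.
  have h3 : boundaryRank M' (Set.Iic r) ≤ 4 :=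
    (boundaryRank_le_of_roots (fun v : Fin 6 => Fin.ofNat 6 (v.val % 2)) (fun u v huv hm =>
      congrArg (Fin.ofNat 6) ((hM' u v huv).1 hm).2)).trans (by decide)
  have h4 : Fintype.card (Fin 6) ≤ boundaryRank M (Set.Iic r) + 1 := by
    refine le_boundaryRank_of_connected h0 hs (Set.mem_Iic.2 hr) 0 fun v => ?_
    have hstep : ∀ i : Fin 6, i ≠ i + 1 ∧ M i (i + 1) ∈ Set.Iic r := fun i =>
      have hi : i ≠ i + 1 := by revert i; decide
      ⟨hi, (hM _ _ hi).2 (Or.inr rfl)⟩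
    induction v using Fin.induction with
    | zero => exact .refl
    | succ i ih =>
      refine ih.tail ?_
      have := hstep i.castSucc
      rwa [Fin.coeSucc_eq_succ] at this
  rw [Fintype.card_fin] at h1 h4
  omega

/-! ### The three models -/

theorem countable_boundedGraphs {N : ℕ} {χ : Set (Fin N → ℝ)} (hχ : χ.Countable) (n : ℕ) :
    (boundedGraphs χ n).Countable := by
  have := hχ.to_subtype
  refine (Set.countable_range fun p : Σ k : ℕ, SimpleGraph (Fin k) × (Fin k → χ) =>
    (⟨p.1, p.2.1, fun v => (p.2.2 v).1⟩ : FGraph N)).mono fun G hG => ?_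
  exact ⟨⟨G.order, G.graph, fun v => ⟨G.feat v, hG.2 v⟩⟩, rfl⟩

section Models

variable {σ : ℝ → ℝ} {N : ℕ}

theorem two_mul_sq_le {n a b : ℕ} (ha : a ≤ n) (hb : b ≤ n) : (a + b) ^ 2 ≤ (n + n) ^ 2 + 1 :=
  (Nat.pow_le_pow_left (Nat.add_le_add ha hb) 2).trans (Nat.le_succ _)

theorem diagram_hexagon_ne {d : ℕ} {θ : LGVRWeights d} (a : Fin N → ℝ)
    {c : Fin (constGraph hexagon a).order → (Fin d → ℝ)}
    {c' : Fin (constGraph twoTriangles a).order → (Fin d → ℝ)}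
    (h : ∀ u v, u ≠ v → (θ.filtrationMatrix σ (constGraph hexagon a).graph c u v ≤ 1 / 2 ↔
      (constGraph hexagon a).graph.Adj u v))
    (h' : ∀ u v, u ≠ v → (θ.filtrationMatrix σ (constGraph twoTriangles a).graph c' u v ≤ 1 / 2 ↔
      (constGraph twoTriangles a).graph.Adj u v)) :
    θ.diagram σ (constGraph hexagon a).graph c ≠
      θ.diagram σ (constGraph twoTriangles a).graph c' := by
  intro heq
  have hr : (0 : ℝ) ≤ 1 / 2 := by norm_num
  have key := persistenceDiagram_hexagon_ne hr h h' (filtrationMatrix_self θ _ c)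
    (filtrationMatrix_self θ _ c') (filtrationMatrix_symm θ _ c)
  exact key (Prod.mk_inj.1 heq).1

/-- A node colouring, line graph weights and an encoder such that the encoded diagrams separate
all that the diagrams separate. -/
theorem IsAnalyticSigmoidal.exists_ginlgvr (hσ : IsAnalyticSigmoidal σ) {𝒢 : Set (FGraph N)}
    (hc : 𝒢.Countable) {n : ℕ} (hn : ∀ G ∈ 𝒢, G.order ≤ n) (T : ℕ) :
    ∃ (g : GIN N 1) (θ : LGVRWeights 1) (S : SetEncoder 1),
      (∀ G ∈ 𝒢, ∀ H ∈ 𝒢, ∀ u v, g.eval σ G.graph G.feat u = g.eval σ H.graph H.feat v →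
        wlColor G.graph G.feat (T + 1) u = wlColor H.graph H.feat (T + 1) v) ∧
      (∀ G ∈ 𝒢, ∀ H ∈ 𝒢,
        ∑ u, g.eval σ G.graph G.feat u = ∑ u, g.eval σ H.graph H.feat u →
        (Finset.univ : Finset (Fin G.order)).val.map (wlColor G.graph G.feat (T + 1)) =
          (Finset.univ : Finset (Fin H.order)).val.map (wlColor H.graph H.feat (T + 1))) ∧
      (∀ G ∈ 𝒢, ∀ u v, u ≠ v →
        (θ.filtrationMatrix σ G.graph (g.eval σ G.graph G.feat) u v ≤ 1 / 2 ↔ G.graph.Adj u v)) ∧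
      (∀ G ∈ 𝒢, ∀ H ∈ 𝒢, ∀ u v u' v', G.graph.Adj u v → H.graph.Adj u' v' →
        θ.filtrationMatrix σ G.graph (g.eval σ G.graph G.feat) u v =
          θ.filtrationMatrix σ H.graph (g.eval σ H.graph H.feat) u' v' →
        s(g.eval σ G.graph G.feat u, g.eval σ G.graph G.feat v) =
          s(g.eval σ H.graph H.feat u', g.eval σ H.graph H.feat v')) ∧
      ∀ G ∈ 𝒢, ∀ H ∈ 𝒢, S.eval σ (θ.diagram σ G.graph (g.eval σ G.graph G.feat)) =
        S.eval σ (θ.diagram σ H.graph (g.eval σ H.graph H.feat)) →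
        θ.diagram σ G.graph (g.eval σ G.graph G.feat) =
          θ.diagram σ H.graph (g.eval σ H.graph H.feat) := by
  have := hc.to_subtype
  obtain ⟨g, hg, hgwl⟩ := hσ.exists_gin (V := fun i : 𝒢 => Fin i.1.order)
    (fun i => i.1.graph) T (fun i => i.1.feat)
  obtain ⟨θ, hθ, hθ'⟩ := hσ.exists_lgvrWeights (V := fun i : 𝒢 => Fin i.1.order)
    (fun i => i.1.graph) (fun i => g.eval σ i.1.graph i.1.feat) (n := n)
    (fun i => by simpa using hn i.1 i.2)
  obtain ⟨S, hS⟩ := hσ.exists_setEncoder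
    (fun i : 𝒢 => θ.diagram σ i.1.graph (g.eval σ i.1.graph i.1.feat))
    (fun i p hp => hp.elim mem_persistenceDiagram mem_persistenceDiagram)
  refine ⟨g, θ, S, fun G hG H hH => hgwl ⟨G, hG⟩ ⟨H, hH⟩, fun G hG H hH hsum => ?_,
    fun G hG => hθ ⟨G, hG⟩, fun G hG H hH => hθ' ⟨G, hG⟩ ⟨H, hH⟩,
    fun G hG H hH => hS ⟨G, hG⟩ ⟨H, hH⟩⟩
  exact Multiset.map_eq_map_of_determines (fun u _ v _ => hgwl ⟨G, hG⟩ ⟨H, hH⟩ u v)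
    (map_eq_map_of_sum_eq hg (i := ⟨G, hG⟩) (j := ⟨H, hH⟩) hsum)

/-- Equal representations give equal diagrams, hence equal edge values with multiplicity, hence
equal endpoint colours, hence equal colours of non-isolated nodes. The diagrams retain only the
number of isolated nodes, so `hiso` supplies that their features agree. -/
theorem IsAnalyticSigmoidal.ginlgvr_strictlyMorePowerful (hσ : IsAnalyticSigmoidal σ)
    {𝒢 : Set (FGraph N)} (hc : 𝒢.Countable) {n : ℕ} (hn : ∀ G ∈ 𝒢, G.order ≤ n)
    (hiso : ∀ G ∈ 𝒢, ∀ H ∈ 𝒢, ∀ u v, (∀ w, ¬ G.graph.Adj u w) → (∀ w, ¬ H.graph.Adj v w) →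
      G.feat u = H.feat v) {a : Fin N → ℝ} (h₁ : constGraph hexagon a ∈ 𝒢)
    (h₂ : constGraph twoTriangles a ∈ 𝒢) :
    StrictlyMorePowerful (GINLGVR.rep σ) WLDistinguishes 𝒢 := by
  obtain ⟨g, θ, S, hwl, -, hθ, hdet, hS⟩ := hσ.exists_ginlgvr hc hn ((n + n) ^ 2)
  have hne := diagram_hexagon_ne a (hθ _ h₁) (hθ _ h₂)
  refine ⟨⟨1, 1, g, θ, S⟩, fun G hG H hH htest hrep => ?_, constGraph hexagon a, h₁,
    constGraph twoTriangles a, h₂, not_wlDistinguishes_hexagon a, fun hrep =>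
      hne (hS _ h₁ _ h₂ hrep)⟩
  have hD := hS G hG H hH hrep
  have hD0 := congrArg Prod.fst hD
  have hD1 := congrArg Prod.snd hD
  refine not_wlDistinguishes (two_mul_sq_le (hn G hG) (hn H hH)) ?_ htest
  refine map_univ_eq_of_nonIsolated (G := G.graph) (G' := H.graph) ?_
    (Multiset.map_eq_map_of_determines (fun u _ v _ => hwl G hG H hH u v)
      (map_nonIsolated_eq
        (fun u v h => card_nbrs_eq_of_wlColor (hwl G hG G hG u v h))
        (fun u v h => card_nbrs_eq_of_wlColor (hwl G hG H hH u v h))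
        (fun u v h => card_nbrs_eq_of_wlColor (hwl H hH H hH u v h))
        (Multiset.map_eq_map_of_determines
          (fun p hp q hq => hdet G hG H hH p.1 p.2 q.1 q.2 (mem_dartSet.1 hp) (mem_dartSet.1 hq))
          (map_dartSet_eq (hθ G hG) (hθ H hH) (fun _ _ => filtrationMatrix_pos θ _ _)
            (fun _ _ => filtrationMatrix_pos θ _ _) fun d hd hd' => ?_))))
    (fun u v hu hv => wlColor_eq_of_isolated hu hv (hiso G hG H hH u v hu hv) _)
  · rw [← card_persistenceDiagram_zero (filtrationMatrix_self θ G.graph _)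
        (fun _ _ => filtrationMatrix_pos θ G.graph _) (r := 1 / 2) (by norm_num),
      ← card_persistenceDiagram_zero (filtrationMatrix_self θ H.graph _)
        (fun _ _ => filtrationMatrix_pos θ H.graph _) (r := 1 / 2) (by norm_num)]
    exact congrArg Multiset.card hD0
  · rw [← two_mul_count_persistenceDiagram (filtrationMatrix_self θ G.graph _)
        (filtrationMatrix_symm θ G.graph _) hd hd',
      ← two_mul_count_persistenceDiagram (filtrationMatrix_self θ H.graph _)
        (filtrationMatrix_symm θ H.graph _) hd hd']
    change _ = 2 * (Multiset.count _ (θ.diagram σ H.graph _).1 + Multiset.count _ (θ.diagram σ H.graph _).2)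
    rw [← hD0, ← hD1]
    rfl

/-- For generic `ε`, the combination `x + (1 + ε) y` determines both summands. -/
theorem exists_eps_add {I : Type} [Countable I] {d : ℕ} (x y : I → (Fin d → ℝ)) :
    ∃ ε : ℝ, ∀ i j, x i + (1 + ε) • y i = x j + (1 + ε) • y j → x i = x j ∧ y i = y j := by
  obtain ⟨ε, hε⟩ := exists_notMem_of_countable (Set.countable_range
    fun q : (I × I) × Fin d =>
      (x q.1.2 q.2 - x q.1.1 q.2) / (y q.1.1 q.2 - y q.1.2 q.2) - 1)
  refine ⟨ε, fun i j h => ?_⟩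
  have hy : y i = y j := by
    by_contra hne
    obtain ⟨k, hk⟩ := Function.ne_iff.1 hne
    refine hε ⟨((i, j), k), ?_⟩
    have hk' := sub_ne_zero.2 hk
    have := congrFun h k
    simp only [Pi.add_apply, Pi.smul_apply, smul_eq_mul] at this
    simp only
    rw [sub_eq_iff_eq_add, div_eq_iff hk']
    linarith
  rw [hy] at h
  exact ⟨add_right_cancel h, hy⟩

/-- The sum of node colours already covers WL, isolated nodes included; the diagrams are needed only
for the strictness. -/
theorem IsAnalyticSigmoidal.ginlgvrPlus_strictlyMorePowerful (hσ : IsAnalyticSigmoidal σ)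
    {𝒢 : Set (FGraph N)} (hc : 𝒢.Countable) {n : ℕ} (hn : ∀ G ∈ 𝒢, G.order ≤ n)
    {a : Fin N → ℝ} (h₁ : constGraph hexagon a ∈ 𝒢) (h₂ : constGraph twoTriangles a ∈ 𝒢) :
    StrictlyMorePowerful (GINLGVRPlus.rep σ) WLDistinguishes 𝒢 := by
  have := hc.to_subtype
  obtain ⟨g, θ, S, -, hsum, hθ, -, hS⟩ := hσ.exists_ginlgvr hc hn ((n + n) ^ 2)
  obtain ⟨ε, hε⟩ := exists_eps_add
    (fun i : 𝒢 => S.eval σ (θ.diagram σ i.1.graph (g.eval σ i.1.graph i.1.feat)))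
    (fun i : 𝒢 => ∑ u, g.eval σ i.1.graph i.1.feat u)
  have hne := diagram_hexagon_ne a (hθ _ h₁) (hθ _ h₂)
  refine ⟨⟨1, g, θ, S, ε⟩, fun G hG H hH htest hrep => ?_, constGraph hexagon a, h₁,
    constGraph twoTriangles a, h₂, not_wlDistinguishes_hexagon a, fun hrep =>
      hne (hS _ h₁ _ h₂ (hε ⟨_, h₁⟩ ⟨_, h₂⟩ hrep).1)⟩
  exact not_wlDistinguishes (two_mul_sq_le (hn G hG) (hn H hH))
    (hsum G hG H hH (hε ⟨G, hG⟩ ⟨H, hH⟩ hrep).2) htest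

theorem IsAnalyticSigmoidal.ppgnlgvrPlus_atLeastAsPowerful (hσ : IsAnalyticSigmoidal σ)
    {𝒢 : Set (FGraph N)} (hc : 𝒢.Countable) {n : ℕ} (hn : ∀ G ∈ 𝒢, G.order ≤ n) :
    AtLeastAsPowerful (PPGNLGVRPlus.rep σ) (KWLDistinguishes 3) 𝒢 := by
  have := hc.to_subtype
  -- The first term is the number of rounds after which colours of triples are stable; the other 3
  -- rounds are spent in passing from diagonal colours to triples.
  obtain ⟨P, hP⟩ := hσ.exists_ppgn (V := fun i : 𝒢 => Fin i.1.order) ((n ^ 3 + n ^ 3) ^ 2 + 3)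
    (fun i => ppgnInput i.1.graph i.1.feat)
  -- The sum of node colours suffices, so the topological part may be arbitrary; a generic `ε`
  -- prevents it from cancelling the sum.
  let zeroMLP : ∀ a b, MLP a b := fun a b => .shallow (h := 0) 0 0 0 0
  let zeroGIN : ∀ a b, GIN a b := fun a b => ⟨0, zeroMLP _ _, .one 0 (zeroMLP _ _)⟩
  let θ : LGVRWeights (1 + 1) := ⟨zeroMLP _ _, 0, 0, zeroGIN _ _, zeroGIN _ _⟩
  let S : SetEncoder (1 + 1) := ⟨0, 0, zeroMLP _ _, zeroMLP _ _, zeroMLP _ _⟩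
  obtain ⟨ε, hε⟩ := exists_eps_add
    (fun i : 𝒢 => S.eval σ (θ.diagram σ i.1.graph
      fun u => P.eval σ (ppgnInput i.1.graph i.1.feat) u u))
    (fun i : 𝒢 => ∑ u, P.eval σ (ppgnInput i.1.graph i.1.feat) u u)
  refine ⟨⟨1 + 1, P, θ, S, ε⟩, fun G hG H hH htest hrep => ?_⟩
  refine not_kwlDistinguishes (T := (n ^ 3 + n ^ 3) ^ 2) ?_ ?_ htest
  · have := hn G hG
    have := hn H hH
    gcongr
  · exact map_kwlColor_eq_of_folkloreColor _
      (hP ⟨G, hG⟩ ⟨H, hH⟩ (hε ⟨G, hG⟩ ⟨H, hH⟩ hrep).2)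

end Models

theorem constGraph_mem_boundedGraphs {N n : ℕ} {χ : Set (Fin N → ℝ)} (hn : 6 ≤ n) {c : Fin N → ℝ}
    (hc : c ∈ χ) (G : SimpleGraph (Fin 6)) : constGraph G c ∈ boundedGraphs χ n :=
  ⟨hn, fun _ => hc⟩

theorem noIsolated_constGraph {N : ℕ} {G : SimpleGraph (Fin 6)} (h : ∀ u, (nbrs G u).card = 2)
    (c : Fin N → ℝ) : (constGraph G c).NoIsolated := fun u =>
  (card_nbrs_pos (G := G)).1 (by rw [h u]; norm_num)

theorem corollary6p3 (σ : ℝ → ℝ) (hσ : IsAnalyticSigmoidal σ) (N : ℕ) (χ : Set (Fin N → ℝ))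
    (hχ : χ.Countable) (h0 : 0 ∈ χ) (n : ℕ) (hn : 6 ≤ n) :
    ((∀ c ∈ χ, StrictlyMorePowerful (GINLGVR.rep σ) WLDistinguishes
          {G ∈ boundedGraphs χ n | ∀ v, G.feat v = c}) ∧
      StrictlyMorePowerful (GINLGVR.rep σ) WLDistinguishes
          {G ∈ boundedGraphs χ n | G.NoIsolated}) ∧
    StrictlyMorePowerful (GINLGVRPlus.rep σ) WLDistinguishes (boundedGraphs χ n) ∧
    AtLeastAsPowerful (PPGNLGVRPlus.rep σ) (KWLDistinguishes 3) (boundedGraphs χ n) := by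
  have hcount := countable_boundedGraphs hχ n
  have hmem : ∀ {c}, c ∈ χ → ∀ G, constGraph G c ∈ boundedGraphs χ n :=
    fun hc G => constGraph_mem_boundedGraphs hn hc G
  refine ⟨⟨fun c hc => ?_, ?_⟩, ?_, ?_⟩
  · exact hσ.ginlgvr_strictlyMorePowerful (hcount.mono fun _ h => h.1) (fun _ h => h.1.1)
      (fun G hG H hH u v _ _ => (hG.2 u).trans (hH.2 v).symm)
      (a := c) ⟨hmem hc _, fun _ => rfl⟩ ⟨hmem hc _, fun _ => rfl⟩
  · exact hσ.ginlgvr_strictlyMorePowerful (hcount.mono fun _ h => h.1) (fun _ h => h.1.1)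
      -- The condition on isolated nodes is vacuous here.
      (fun G hG _ _ u _ hu _ => absurd (hG.2 u) (not_exists.2 hu)) (a := 0)
      ⟨hmem h0 _, noIsolated_constGraph card_nbrs_hexagon 0⟩
      ⟨hmem h0 _, noIsolated_constGraph card_nbrs_twoTriangles 0⟩
  · exact hσ.ginlgvrPlus_strictlyMorePowerful hcount (fun _ h => h.1) (hmem h0 _) (hmem h0 _)
  · exact hσ.ppgnlgvrPlus_atLeastAsPowerful hcount fun _ h => h.1
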